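/- Let $p,m\ge 0$ be integers and let $F(z)=\sum_k z^kB_k$ be a $p\times m$-valued Laurent polynomial (a Finite Impulse Response function), where $B_k\in\mathbb C^{p\times m}$ for $k\in\mathbb Z$ and all but finitely many $B_k$ vanish. Call $F$ causal if $B_k=0$ for all $k>0$, and anti-causal if $B_k=0$ for all $k<0$. Let $d$ be the McMillan degree of $F$, i.e. $d=d_r+d_l$, where $d_r$ is the least $\nu\ge 0$ for which there are constant matrices $A\in\mathbb C^{\nu\times\nu}$, $B\in\mathbb C^{\nu\times m}$, $C\in\mathbb C^{p\times\nu}$ such that $\sum_{k<0}z^kB_k=C(zI_\nu-A)^{-1}B$, and $d_l$ is the least $\nu\ge 0$ for which there are such matrices with $\sum_{k>0}z^kB_k=C(z^{-1}I_\nu-A)^{-1}B$ (identities of rational functions). **I.** Assume $p\ge m$. Then $F$ is isometric on the unit circle, i.e. $F(z)^*F(z)=I_m$ for all $z\in\mathbb C$ with $|z|=1$, if and only if there are an integer $\gamma\in[0,d]$, vectors $v_1,\dots,v_d\in\mathbb C^p$ with $v_j^*v_j=1$, and $U\in\mathbb C^{p\times m}$ with $U^*U=I_m$, such that for all $z\neq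 0$ the matrix $F(z)$ can be written in one, and hence in each, of the three forms $$\begin{aligned} F(z)&=\prod_{j=1}^{\gamma}\bigl(I_p+(z-1)v_jv_j^*\bigr)\prod_{j=\gamma+1}^{d}\bigl(I_p+(\tfrac1z-1)v_jv_j^*\bigr)\,U,\\ F(z)&=\prod_{j=1}^{\gamma}\bigl(I_p+(z-1)v_jv_j^*\bigr)\Bigl(\prod_{j=d}^{\gamma+1}\bigl(I_p+(z-1)v_jv_j^*\bigr)\Bigr)^{-1}U,\\ F(z)&=\Bigl(\prod_{j=\gamma}^{1}\bigl(I_p+(\tfrac1z-1)v_jv_j^*\bigr)\Bigr)^{-1}\prod_{j=\gamma+1}^{d}\bigl(I_p+(\tfrac1z-1)v_jv_j^*\bigr)\,U . \end{aligned}$$ **II.** Assume $m\ge p$. Then $F$ is co-isometric on the unit circle, i.e. $F(z)F(z)^*=I_p$ for all $z\in\mathbb C$ with $|z|=1$, if and only if there are an integer $\gamma\in[0,d]$, vectors $v_1,\dots,v_d\in\mathbb C^m$ with $v_j^*v_j=1$, and $U\in\mathbb C^{p\times m}$ with $UU^*=I_p$, such that for all $z\neq 0$ the matrix $F(z)$ can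 be written in one, and hence in each, of the three forms $$\begin{aligned} F(z)&=U\prod_{j=\gamma+1}^{d}\bigl(I_m+(\tfrac1z-1)v_jv_j^*\bigr)\prod_{j=1}^{\gamma}\bigl(I_m+(z-1)v_jv_j^*\bigr),\\ F(z)&=U\Bigl(\prod_{j=d}^{\gamma+1}\bigl(I_m+(z-1)v_jv_j^*\bigr)\Bigr)^{-1}\prod_{j=1}^{\gamma}\bigl(I_m+(z-1)v_jv_j^*\bigr),\\ F(z)&=U\prod_{j=\gamma+1}^{d}\bigl(I_m+(\tfrac1z-1)v_jv_j^*\bigr)\Bigl(\prod_{j=\gamma}^{1}\bigl(I_m+(\tfrac1z-1)v_jv_j^*\bigr)\Bigr)^{-1}. \end{aligned}$$ Here products are ordered from left to right, with the index running from its lower to its upper limit as written (increasing for $\prod_{j=a}^{b}$ with $a\le b$; decreasing in the products under the inverses, $\prod_{j=d}^{\gamma+1}$ and $\prod_{j=\gamma}^{1}$), and products without factors are the identity. In each of I and II, for the same $\gamma$, $v_j$ and $U$ the three forms are equivalent to one another. In particular, a function $F$ so written is causal if $\gamma=0$ and anti-causal if $\gamma=d$. -/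

import Mathlib

open Matrix

noncomputable section

/-- A `p × m`-valued Finite Impulse Response function, i.e. a Laurent polynomial
`F(z) = ∑ₖ z ^ k • Bₖ` with coefficients `Bₖ = F k` in `ℂ ^ (p × m)`, all but finitely many zero. -/
abbrev FIR (p m : ℕ) : Type := ℤ →₀ Matrix (Fin p) (Fin m) ℂ

namespace FIR

variable {p m : ℕ}

/-- The value `F(z) = ∑ₖ z ^ k • Bₖ`; meaningful for `z ≠ 0`. -/
def eval (F : FIR p m) (z : ℂ) : Matrix (Fin p) (Fin m) ℂ :=
  F.sum fun k B => z ^ k • B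

/-- Causal: no positive powers of `z`. -/
def IsCausal (F : FIR p m) : Prop := ∀ k : ℤ, 0 < k → F k = 0

/-- Anti-causal: no negative powers of `z`. -/
def IsAntiCausal (F : FIR p m) : Prop := ∀ k : ℤ, k < 0 → F k = 0

/-- `F` is isometric on the unit circle: `F(z)^* F(z) = I_m` whenever `|z| = 1`. -/
def IsIsometric (F : FIR p m) : Prop :=
  ∀ z : ℂ, ‖z‖ = 1 → (F.eval z)ᴴ * F.eval z = 1

/-- `F` is co-isometric on the unit circle: `F(z) F(z)^* = I_p` whenever `|z| = 1`. -/
def IsCoisometric (F : FIR p m) : Prop :=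
  ∀ z : ℂ, ‖z‖ = 1 → F.eval z * (F.eval z)ᴴ = 1

/-- The strictly causal part `F_r(z) = ∑_{k < 0} z ^ k • Bₖ`. -/
def rightPart (F : FIR p m) : FIR p m := F.filter (fun k => k < 0)

/-- The strictly anti-causal part `F_l(z) = ∑_{k > 0} z ^ k • Bₖ`. -/
def leftPart (F : FIR p m) : FIR p m := F.filter (fun k => 0 < k)

/-- `(A, B, C)` is a state space realization of the function `G` vanishing at infinity:
`G(z) = C (z I - A)⁻¹ B`, for all `z ≠ 0` that are not eigenvalues of `A`. (The functions `G`
used below have `0` as their only possible finite pole.) -/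
def IsRealization (G : ℂ → Matrix (Fin p) (Fin m) ℂ) {ν : ℕ}
    (A : Matrix (Fin ν) (Fin ν) ℂ) (B : Matrix (Fin ν) (Fin m) ℂ)
    (C : Matrix (Fin p) (Fin ν) ℂ) : Prop :=
  ∀ z : ℂ, z ≠ 0 → IsUnit (z • (1 : Matrix (Fin ν) (Fin ν) ℂ) - A).det →
    G z = C * (z • (1 : Matrix (Fin ν) (Fin ν) ℂ) - A)⁻¹ * B

/-- The dimension of the state space of a minimal realization of `G`. -/
def minimalStateDim (G : ℂ → Matrix (Fin p) (Fin m) ℂ) : ℕ :=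
  sInf {ν : ℕ | ∃ (A : Matrix (Fin ν) (Fin ν) ℂ) (B : Matrix (Fin ν) (Fin m) ℂ)
    (C : Matrix (Fin p) (Fin ν) ℂ), IsRealization G A B C}

/-- The McMillan degree of `F = F_l + D + F_r`: the minimal state space dimension of the strictly
causal part `F_r(z) = C (z I - A)⁻¹ B` (this counts the poles at `0`), plus that of the strictly
anti-causal part, realized in the variable `w = 1 / z`, namely `F_l(z) = C (z⁻¹ I - A)⁻¹ B`
(this counts the poles at infinity). The constant term `D` does not contribute. -/
def mcMillanDegree (F : FIR p m) : ℕ :=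
  minimalStateDim (fun z => F.rightPart.eval z) +
    minimalStateDim (fun w => F.leftPart.eval w⁻¹)

/-- The elementary factor `I + (c - 1) v v^*`, used with `c = z` and `c = 1 / z`. -/
def elemFactor {k : ℕ} (v : Fin k → ℂ) (c : ℂ) : Matrix (Fin k) (Fin k) ℂ :=
  1 + (c - 1) • vecMulVec v (star v)

/-- The ordered product `M_a M_{a+1} ⋯ M_b` (the identity if `b < a`). -/
def prodAsc {k : ℕ} (a b : ℕ) (M : ℕ → Matrix (Fin k) (Fin k) ℂ) : Matrix (Fin k) (Fin k) ℂ :=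
  ((List.range' a (b + 1 - a)).map M).prod

/-- The ordered product `M_b M_{b-1} ⋯ M_a` (the identity if `b < a`). -/
def prodDesc {k : ℕ} (b a : ℕ) (M : ℕ → Matrix (Fin k) (Fin k) ℂ) : Matrix (Fin k) (Fin k) ℂ :=
  ((List.range' a (b + 1 - a)).reverse.map M).prod

/-- The admissible parameters `0 ≤ γ ≤ d` and unit vectors `v_1, …, v_d` in `ℂ ^ k`
(the values `v j` for other `j` play no role). -/
def Admissible {k : ℕ} (d γ : ℕ) (v : ℕ → Fin k → ℂ) : Prop :=
  γ ≤ d ∧ ∀ j : ℕ, 1 ≤ j → j ≤ d → star (v j) ⬝ᵥ v j = 1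

/-- First isometric form. -/
def IsoForm₁ (F : FIR p m) (d γ : ℕ) (v : ℕ → Fin p → ℂ) (U : Matrix (Fin p) (Fin m) ℂ) : Prop :=
  ∀ z : ℂ, z ≠ 0 → F.eval z =
    prodAsc 1 γ (fun j => elemFactor (v j) z) *
      prodAsc (γ + 1) d (fun j => elemFactor (v j) (1 / z)) * U

/-- Second isometric form. -/
def IsoForm₂ (F : FIR p m) (d γ : ℕ) (v : ℕ → Fin p → ℂ) (U : Matrix (Fin p) (Fin m) ℂ) : Prop :=
  ∀ z : ℂ, z ≠ 0 → F.eval z =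
    prodAsc 1 γ (fun j => elemFactor (v j) z) *
      (prodDesc d (γ + 1) (fun j => elemFactor (v j) z))⁻¹ * U

/-- Third isometric form. -/
def IsoForm₃ (F : FIR p m) (d γ : ℕ) (v : ℕ → Fin p → ℂ) (U : Matrix (Fin p) (Fin m) ℂ) : Prop :=
  ∀ z : ℂ, z ≠ 0 → F.eval z =
    (prodDesc γ 1 (fun j => elemFactor (v j) (1 / z)))⁻¹ *
      prodAsc (γ + 1) d (fun j => elemFactor (v j) (1 / z)) * U

/-- First co-isometric form. -/
def CoisoForm₁ (F : FIR p m) (d γ : ℕ) (v : ℕ → Fin m → ℂ) (U : Matrix (Fin p) (Fin m) ℂ) :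
    Prop :=
  ∀ z : ℂ, z ≠ 0 → F.eval z =
    U * prodAsc (γ + 1) d (fun j => elemFactor (v j) (1 / z)) *
      prodAsc 1 γ (fun j => elemFactor (v j) z)

/-- Second co-isometric form. -/
def CoisoForm₂ (F : FIR p m) (d γ : ℕ) (v : ℕ → Fin m → ℂ) (U : Matrix (Fin p) (Fin m) ℂ) :
    Prop :=
  ∀ z : ℂ, z ≠ 0 → F.eval z =
    U * (prodDesc d (γ + 1) (fun j => elemFactor (v j) z))⁻¹ *
      prodAsc 1 γ (fun j => elemFactor (v j) z)

/-- Third co-isometric form. -/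
def CoisoForm₃ (F : FIR p m) (d γ : ℕ) (v : ℕ → Fin m → ℂ) (U : Matrix (Fin p) (Fin m) ℂ) :
    Prop :=
  ∀ z : ℂ, z ≠ 0 → F.eval z =
    U * prodAsc (γ + 1) d (fun j => elemFactor (v j) (1 / z)) *
      (prodDesc γ 1 (fun j => elemFactor (v j) (1 / z)))⁻¹

end FIR

end

/-!
Write `P` for `F` as a matrix over the ring `ℂ[T;T⁻¹]` of Laurent polynomials. Since a Laurent
polynomial vanishing on the unit circle is zero, `F` is isometric if and only if `P~ P = 1`, where
`P~(z) = P(1 / conj z)^*`.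

The McMillan degree is a sum of two Hankel ranks. Let `X` be the space of the parts with positive
powers of `z` of all `P k`, with `k` a vector of polynomials in `1 / z`. The shift on `X` is a
realization of the strictly anti-causal part of `P`; conversely the Markov parameters of any
realization are `C A ^ k B`, so its dimension is at least `dim X`
(`minimalStateDim_eq_hankelRank`). The strictly causal part is treated by the substitution
`z ↦ 1 / z` (`mirror`).

If `X ≠ 0`, then `X`, being invariant under a nilpotent shift, contains some `z v` with `v` a unit
vector. Multiply `P` from the left by `E = I + (1 / z - 1) v v^*`. The new space is the image of `X`
under a map with kernel spanned by `z v`, so the Hankel rank at infinity drops by exactly one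
(`hankelRank_elemL_mul`). The Hankel rank at zero does not change
(`hankelRank_mirror_elemL_mul`): it depends only on the set of polynomial vectors `h` for which
`P h` is polynomial, and for such `h` the vector `E P h` is again polynomial, because `v` is
orthogonal to the constant term of `P h`. Indeed, if `P k = z v + (polynomial in 1 / z)` then, `P`
being isometric, the inner product of `v` with that constant term is `⟨P k, z P h⟩ = ⟨k, z h⟩ = 0`
(`star_dotProduct_coeff_zero_eq_zero`).

By induction `P` is a product of as many factors in `z` as its Hankel rank at infinity, and an
isometric matrix without positive powers of `z`; the same argument after `z ↦ 1 / z` splits off the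
factors in `1 / z`, and a constant isometry `U` remains (`exists_factorization`). The number of
factors is the McMillan degree. The co-isometric case is that of `z ↦ F(conj z)^*`. The three forms
agree because `I + (z - 1) v v^*` and `I + (1 / z - 1) v v^*` are inverse to each other.
-/

noncomputable section

namespace FIR

open scoped LaurentPolynomial
open LaurentPolynomial (T)

variable {p m : ℕ}

/-! ### Laurent polynomials and their values -/

lemma coeff_mul_C_mul_T (f : ℂ[T;T⁻¹]) (a : ℂ) (n l : ℤ) :
    (f * (LaurentPolynomial.C a * T n)).coeff l = f.coeff (l - n) * a := by
  rw [← LaurentPolynomial.single_eq_C_mul_T]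
  simp [sub_eq_add_neg, -LaurentPolynomial.single_eq_C_mul_T]

lemma coeff_C_mul (f : ℂ[T;T⁻¹]) (a : ℂ) (l : ℤ) :
    (LaurentPolynomial.C a * f).coeff l = a * f.coeff l := by
  rw [← LaurentPolynomial.smul_eq_C_mul]; rfl

lemma coeff_mul_T (f : ℂ[T;T⁻¹]) (n l : ℤ) : (f * T n).coeff l = f.coeff (l - n) := by
  simpa using coeff_mul_C_mul_T f 1 n l

/-- The coefficientwise form of `f ↦ conj (f (1 / conj z))`, which on the unit circle is complex
conjugation of the values. -/
def tilde : ℂ[T;T⁻¹] →+* ℂ[T;T⁻¹] :=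
  (AddMonoidAlgebra.mapRingHom ℤ (starRingEnd ℂ)).comp
    (LaurentPolynomial.invert (R := ℂ)).toRingEquiv.toRingHom

lemma tilde_coeff (f : ℂ[T;T⁻¹]) (n : ℤ) : (tilde f).coeff n = star (f.coeff (-n)) := by
  simp [tilde]

/-- Evaluation of Laurent polynomials at a nonzero point. -/
def evalAt (z : ℂˣ) : ℂ[T;T⁻¹] →+* ℂ := LaurentPolynomial.eval₂ (RingHom.id ℂ) z

lemma evalAt_C_mul_T (z : ℂˣ) (a : ℂ) (n : ℤ) :
    evalAt z (LaurentPolynomial.C a * T n) = a * (z : ℂ) ^ n := by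
  simp [evalAt]

lemma evalAt_C (z : ℂˣ) (a : ℂ) : evalAt z (LaurentPolynomial.C a) = a := by
  simp [evalAt]

lemma evalAt_T (z : ℂˣ) (n : ℤ) : evalAt z (T n) = (z : ℂ) ^ n := by
  simp [evalAt]

lemma evalAt_tilde (z : ℂˣ) (hz : ‖(z : ℂ)‖ = 1) (f : ℂ[T;T⁻¹]) :
    evalAt z (tilde f) = star (evalAt z f) := by
  induction f using LaurentPolynomial.induction_on' with
  | add f g hf hg => simp [hf, hg]
  | C_mul_T n a =>
    have h : tilde (LaurentPolynomial.C a * T n) = LaurentPolynomial.C (star a) * T (-n) := by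
      ext l
      rw [tilde_coeff, ← LaurentPolynomial.single_eq_C_mul_T,
        ← LaurentPolynomial.single_eq_C_mul_T]
      simp only [AddMonoidAlgebra.coeff_single, Finsupp.single_apply]
      by_cases hl : n = -l
      · simp [hl]
      · rw [if_neg hl, if_neg (by omega), star_zero]
    have hz' : (starRingEnd ℂ) (z : ℂ) = (z : ℂ)⁻¹ := (Complex.inv_eq_conj hz).symm
    rw [h, evalAt_C_mul_T, evalAt_C_mul_T]
    simp [hz']

lemma infinite_unitCircle : {z : ℂ | ‖z‖ = 1}.Infinite := by
  have h : IsPreconnected (Metric.sphere (0 : ℂ) 1) :=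
    isPreconnected_sphere (by simp [Complex.rank_real_complex]) 0 1
  have h2 : (Metric.sphere (0 : ℂ) 1).Nontrivial := ⟨1, by simp, -1, by simp, by norm_num⟩
  have := h.infinite_of_nontrivial h2
  convert this using 1
  ext z; simp

lemma eq_zero_of_evalAt_eq_zero (f : ℂ[T;T⁻¹])
    (h : ∀ z : ℂˣ, ‖(z : ℂ)‖ = 1 → evalAt z f = 0) : f = 0 := by
  obtain ⟨n, g, hg⟩ := LaurentPolynomial.exists_T_pow f
  have hg0 : g = 0 := by
    refine Polynomial.eq_zero_of_infinite_isRoot g (infinite_unitCircle.mono fun z hz => ?_)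
    have hz0 : z ≠ 0 := by rintro rfl; simp at hz
    have h1 := congrArg (evalAt (Units.mk0 z hz0)) hg
    rw [map_mul, h (Units.mk0 z hz0) hz, zero_mul] at h1
    simpa [evalAt, Polynomial.eval₂_id] using h1
  rw [hg0, map_zero] at hg
  exact ((LaurentPolynomial.isUnit_T (R := ℂ) n).mul_left_eq_zero).1 hg.symm

lemma ext_of_evalAt {k l : ℕ} {P Q : Matrix (Fin k) (Fin l) ℂ[T;T⁻¹]}
    (h : ∀ z : ℂˣ, ‖(z : ℂ)‖ = 1 → P.map (evalAt z) = Q.map (evalAt z)) : P = Q := by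
  ext1 i j
  refine sub_eq_zero.1 (eq_zero_of_evalAt_eq_zero _ fun z hz => ?_)
  have := congrFun (congrFun (h z hz) i) j
  simpa [sub_eq_zero] using this

/-- An FIR function as a matrix of Laurent polynomials. -/
def toLaurent (F : FIR p m) : Matrix (Fin p) (Fin m) ℂ[T;T⁻¹] :=
  .of fun i j => .ofCoeff (F.mapRange (fun B => B i j) rfl)

lemma toLaurent_coeff (F : FIR p m) (i : Fin p) (j : Fin m) (n : ℤ) :
    (F.toLaurent i j).coeff n = F n i j := rfl

lemma eval_add (F G : FIR p m) (z : ℂ) : eval (F + G) z = eval F z + eval G z :=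
  Finsupp.sum_add_index' (by simp) (by simp)

lemma eval_single (k : ℤ) (B : Matrix (Fin p) (Fin m) ℂ) (z : ℂ) :
    eval (Finsupp.single k B) z = z ^ k • B :=
  Finsupp.sum_single_index (by simp)

lemma map_evalAt_toLaurent (F : FIR p m) (z : ℂˣ) :
    F.toLaurent.map (evalAt z) = F.eval z := by
  induction F using Finsupp.induction_linear with
  | zero =>
    ext i j
    have : (toLaurent (0 : FIR p m)) i j = 0 := by ext l; rfl
    simp [this, eval]
  | add F G hF hG =>
    rw [eval_add, ← hF, ← hG]
    ext i j
    have : toLaurent (F + G) i j = toLaurent F i j + toLaurent G i j := by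
      ext l; rfl
    simp [this]
  | single k B =>
    ext i j
    have : toLaurent (Finsupp.single k B) i j = LaurentPolynomial.C (B i j) * T k := by
      rw [← LaurentPolynomial.single_eq_C_mul_T]
      ext l
      rw [toLaurent_coeff, AddMonoidAlgebra.coeff_single, Finsupp.single_apply,
        Finsupp.single_apply]
      split_ifs <;> rfl
    rw [eval_single, map_apply, this, evalAt_C_mul_T, Matrix.smul_apply, smul_eq_mul, mul_comm]

/-- The adjoint `P~(z) = P(1 / conj z)^*` of a matrix of Laurent polynomials. -/
def para (P : Matrix (Fin p) (Fin m) ℂ[T;T⁻¹]) : Matrix (Fin m) (Fin p) ℂ[T;T⁻¹] :=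
  Pᵀ.map tilde

lemma map_evalAt_para (P : Matrix (Fin p) (Fin m) ℂ[T;T⁻¹]) (z : ℂˣ) (hz : ‖(z : ℂ)‖ = 1) :
    (para P).map (evalAt z) = (P.map (evalAt z))ᴴ := by
  ext i j
  simp [para, evalAt_tilde z hz]

lemma para_mul {k l n : ℕ} (P : Matrix (Fin k) (Fin l) ℂ[T;T⁻¹])
    (Q : Matrix (Fin l) (Fin n) ℂ[T;T⁻¹]) : para (P * Q) = para Q * para P := by
  simp only [para, transpose_mul, Matrix.map_mul]

lemma para_mul_self_of_isIsometric {F : FIR p m} (hF : F.IsIsometric) :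
    para F.toLaurent * F.toLaurent = 1 := by
  refine ext_of_evalAt fun z hz => ?_
  rw [Matrix.map_mul, map_evalAt_para _ _ hz, map_evalAt_toLaurent, hF z hz,
    Matrix.map_one _ (map_zero _) (map_one _)]

/-! ### Elementary factors -/

lemma one_add_sub_one_smul_mul {n S : Type*} [Fintype n] [DecidableEq n] [CommRing S]
    {Q : Matrix n n S} (hQ : Q * Q = Q) (a b : S) :
    (1 + (a - 1) • Q) * (1 + (b - 1) • Q) = 1 + (a * b - 1) • Q := by
  simp only [add_mul, mul_add, one_mul, mul_one, smul_mul_assoc, mul_smul_comm, hQ]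
  module

lemma vecMulVec_star_mul_self {k : ℕ} {v : Fin k → ℂ} (hv : star v ⬝ᵥ v = 1) :
    vecMulVec v (star v) * vecMulVec v (star v) = vecMulVec v (star v) := by
  rw [vecMulVec_mul_vecMulVec, hv]; simp

lemma elemFactor_mul {k : ℕ} {v : Fin k → ℂ} (hv : star v ⬝ᵥ v = 1) (a b : ℂ) :
    elemFactor v a * elemFactor v b = elemFactor v (a * b) :=
  one_add_sub_one_smul_mul (vecMulVec_star_mul_self hv) a b

lemma elemFactor_one {k : ℕ} (v : Fin k → ℂ) : elemFactor v 1 = 1 := by simp [elemFactor]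

lemma conjTranspose_elemFactor {k : ℕ} (v : Fin k → ℂ) (a : ℂ) :
    (elemFactor v a)ᴴ = elemFactor v (star a) := by
  simp [elemFactor, conjTranspose_vecMulVec]

/-- The elementary factor `I + (c - 1) v v^*` with a Laurent polynomial `c`. -/
def elemL {k : ℕ} (v : Fin k → ℂ) (c : ℂ[T;T⁻¹]) : Matrix (Fin k) (Fin k) ℂ[T;T⁻¹] :=
  1 + (c - 1) • (vecMulVec v (star v)).map LaurentPolynomial.C

lemma elemL_mul {k : ℕ} {v : Fin k → ℂ} (hv : star v ⬝ᵥ v = 1) (a b : ℂ[T;T⁻¹]) :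
    elemL v a * elemL v b = elemL v (a * b) :=
  one_add_sub_one_smul_mul (by rw [← Matrix.map_mul, vecMulVec_star_mul_self hv]) a b

lemma elemL_one {k : ℕ} (v : Fin k → ℂ) : elemL v 1 = 1 := by simp [elemL]

lemma map_evalAt_elemL {k : ℕ} (v : Fin k → ℂ) (c : ℂ[T;T⁻¹]) (z : ℂˣ) :
    (elemL v c).map (evalAt z) = elemFactor v (evalAt z c) := by
  ext i j
  simp [elemL, elemFactor, Matrix.one_apply, apply_ite (evalAt z), evalAt_C]

/-! ### Hankel operators -/

/-- The sequence of the coefficients of `z, z ^ 2, …` of a vector of Laurent polynomials. Its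
kernel consists of the vectors that are polynomial in `1 / z`. -/
def tail (p : ℕ) : (Fin p → ℂ[T;T⁻¹]) →ₗ[ℂ] (ℕ → Fin p → ℂ) where
  toFun y := fun i j => (y j).coeff (i + 1)
  map_add' x y := by ext; simp
  map_smul' a x := by ext; simp

lemma tail_apply (y : Fin p → ℂ[T;T⁻¹]) (i : ℕ) (j : Fin p) :
    tail p y i j = (y j).coeff (i + 1) := rfl

lemma mem_ker_tail {y : Fin p → ℂ[T;T⁻¹]} :
    y ∈ LinearMap.ker (tail p) ↔ ∀ j, ∀ n : ℤ, 0 < n → (y j).coeff n = 0 := by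
  rw [LinearMap.mem_ker]
  constructor
  · intro h j n hn
    have := congrFun (congrFun h (n - 1).toNat) j
    rw [tail_apply] at this
    rw [← show ((n - 1).toNat : ℤ) + 1 = n by omega]
    exact this
  · intro h
    ext i j
    exact h j _ (by positivity)

/-- Multiplication by `P` followed by `tail`: its restriction to the polynomials in `1 / z` is the
Hankel operator of `P` at infinity. -/
def hankel (P : Matrix (Fin p) (Fin m) ℂ[T;T⁻¹]) : (Fin m → ℂ[T;T⁻¹]) →ₗ[ℂ] (ℕ → Fin p → ℂ) :=
  tail p ∘ₗ P.mulVecLin.restrictScalars ℂ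

lemma hankel_apply (P : Matrix (Fin p) (Fin m) ℂ[T;T⁻¹]) (k : Fin m → ℂ[T;T⁻¹]) :
    hankel P k = tail p (P *ᵥ k) := rfl

/-- The range of the Hankel operator of `P` at infinity. -/
def hankelRange (P : Matrix (Fin p) (Fin m) ℂ[T;T⁻¹]) : Submodule ℂ (ℕ → Fin p → ℂ) :=
  (LinearMap.ker (tail m)).map (hankel P)

/-- The rank of the Hankel operator of `P` at infinity, i.e. the McMillan degree of the part of `P`
with positive powers of `z`. -/
def hankelRank (P : Matrix (Fin p) (Fin m) ℂ[T;T⁻¹]) : ℕ := Module.finrank ℂ (hankelRange P)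

/-- The monomial vector `z ^ n • u`. -/
def mono (u : Fin m → ℂ) (n : ℤ) : Fin m → ℂ[T;T⁻¹] := fun j => LaurentPolynomial.C (u j) * T n

lemma mono_coeff (u : Fin m → ℂ) (n l : ℤ) (j : Fin m) :
    (mono u n j).coeff l = if n = l then u j else 0 := by
  rw [mono, ← LaurentPolynomial.single_eq_C_mul_T, AddMonoidAlgebra.coeff_single,
    Finsupp.single_apply]

lemma mono_mem_ker_tail (u : Fin m → ℂ) (n : ℕ) : mono u (-n) ∈ LinearMap.ker (tail m) := by
  rw [mem_ker_tail]
  intro j l hl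
  rw [mono_coeff, if_neg (by omega)]

lemma ker_tail_le_span :
    LinearMap.ker (tail m) ≤ Submodule.span ℂ {y | ∃ u : Fin m → ℂ, ∃ n : ℕ, y = mono u (-n)} := by
  intro y hy
  rw [mem_ker_tail] at hy
  have h : y = ∑ n ∈ Finset.univ.biUnion (fun j => (y j).coeff.support),
      mono (fun j => (y j).coeff n) n := by
    ext j l
    simp only [Finset.sum_apply, AddMonoidAlgebra.coeff_sum, Finsupp.coe_finsetSum, mono_coeff]
    rw [Finset.sum_ite_eq']
    split_ifs with hl
    · rfl
    · simp only [Finset.mem_biUnion, Finset.mem_univ, true_and, not_exists,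
        Finsupp.notMem_support_iff] at hl
      exact hl j
  rw [h]
  refine Submodule.sum_mem _ fun n _ => ?_
  by_cases hn : 0 < n
  · have : mono (fun j => (y j).coeff n) n = 0 := by
      ext j l
      rw [mono_coeff, hy j n hn]
      simp
    rw [this]
    exact Submodule.zero_mem _
  · exact Submodule.subset_span ⟨_, (-n).toNat, by rw [show -((-n).toNat : ℤ) = n by omega]⟩

/-- The coefficient of `z ^ n` in a matrix of Laurent polynomials. -/
def coeffMat (P : Matrix (Fin p) (Fin m) ℂ[T;T⁻¹]) (n : ℤ) : Matrix (Fin p) (Fin m) ℂ :=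
  .of fun i j => (P i j).coeff n

lemma hankel_mono (P : Matrix (Fin p) (Fin m) ℂ[T;T⁻¹]) (u : Fin m → ℂ) (n : ℤ) (i : ℕ) :
    hankel P (mono u n) i = coeffMat P (i + 1 - n) *ᵥ u := by
  ext j
  simp [hankel_apply, tail_apply, mulVec, dotProduct, mono, coeffMat, coeff_mul_C_mul_T,
    -LaurentPolynomial.mul_T_assoc]

lemma exists_coeffMat_eq_zero (P : Matrix (Fin p) (Fin m) ℂ[T;T⁻¹]) :
    ∃ N : ℕ, ∀ n : ℤ, N ≤ n → coeffMat P n = 0 := by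
  have h : ∀ f : ℂ[T;T⁻¹], ∃ N : ℕ, ∀ n : ℤ, N ≤ n → f.coeff n = 0 := by
    intro f
    obtain ⟨b, hb⟩ := f.coeff.support.bddAbove
    refine ⟨(b + 1).toNat, fun n hn => ?_⟩
    by_contra hne
    have := hb (Finsupp.mem_support_iff.2 hne)
    omega
  choose N hN using fun i j => h (P i j)
  refine ⟨∑ i, ∑ j, N i j, fun n hn => ?_⟩
  ext i j
  refine hN i j n (le_trans ?_ hn)
  have h1 : N i j ≤ ∑ j, N i j := Finset.single_le_sum (fun _ _ => Nat.zero_le _) (Finset.mem_univ j)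
  have h2 : ∑ j, N i j ≤ ∑ i, ∑ j, N i j :=
    Finset.single_le_sum (f := fun i => ∑ j, N i j) (fun _ _ => Nat.zero_le _) (Finset.mem_univ i)
  exact_mod_cast h1.trans h2

lemma hankelRange_le {P : Matrix (Fin p) (Fin m) ℂ[T;T⁻¹]} {W : Submodule ℂ (ℕ → Fin p → ℂ)}
    (h : ∀ (u : Fin m → ℂ) (n : ℕ), (fun i : ℕ => coeffMat P (i + n + 1) *ᵥ u) ∈ W) :
    hankelRange P ≤ W := by
  refine (Submodule.map_mono ker_tail_le_span).trans ?_
  rw [Submodule.map_span, Submodule.span_le]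
  rintro _ ⟨_, ⟨u, n, rfl⟩, rfl⟩
  have : hankel P (mono u (-n)) = fun i : ℕ => coeffMat P (i + n + 1) *ᵥ u := by
    funext i
    rw [hankel_mono]
    congr 2
    ring
  rw [SetLike.mem_coe, this]
  exact h u n

lemma exists_hankelRange_vanishing (P : Matrix (Fin p) (Fin m) ℂ[T;T⁻¹]) :
    ∃ N : ℕ, ∀ n : ℤ, N ≤ n → coeffMat P n = 0 ∧ ∀ x ∈ hankelRange P, ∀ i : ℕ, N ≤ i → x i = 0 := by
  obtain ⟨N, hN⟩ := exists_coeffMat_eq_zero P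
  refine ⟨N, fun n hn => ⟨hN n hn, fun x hx i hi => ?_⟩⟩
  have : hankelRange P ≤ LinearMap.ker (LinearMap.proj (R := ℂ) (φ := fun _ : ℕ => Fin p → ℂ) i) := by
    refine hankelRange_le fun u n => ?_
    rw [LinearMap.mem_ker, LinearMap.proj_apply, hN _ (by omega), zero_mulVec]
  exact this hx

instance finiteDimensional_hankelRange (P : Matrix (Fin p) (Fin m) ℂ[T;T⁻¹]) :
    FiniteDimensional ℂ (hankelRange P) := by
  obtain ⟨N, hN⟩ := exists_hankelRange_vanishing P
  let f : hankelRange P →ₗ[ℂ] (Fin N → Fin p → ℂ) :=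
    LinearMap.pi fun i => LinearMap.proj (i : ℕ) ∘ₗ (hankelRange P).subtype
  refine FiniteDimensional.of_injective f ((injective_iff_map_eq_zero f).2 fun x hx => ?_)
  ext1
  funext i
  by_cases hi : i < N
  · exact congrFun hx ⟨i, hi⟩
  · exact (hN N le_rfl).2 x x.2 i (by omega)

/-- The backward shift of sequences. -/
def shift (p : ℕ) : (ℕ → Fin p → ℂ) →ₗ[ℂ] (ℕ → Fin p → ℂ) :=
  LinearMap.funLeft ℂ (Fin p → ℂ) Nat.succ

lemma shift_apply (x : ℕ → Fin p → ℂ) (i : ℕ) : shift p x i = x (i + 1) := rfl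

lemma shift_mem_hankelRange (P : Matrix (Fin p) (Fin m) ℂ[T;T⁻¹]) {x : ℕ → Fin p → ℂ}
    (hx : x ∈ hankelRange P) : shift p x ∈ hankelRange P := by
  have : hankelRange P ≤ (hankelRange P).comap (shift p) := by
    refine hankelRange_le fun u n => ⟨mono u (-(n + 1 : ℕ)), mono_mem_ker_tail u _, ?_⟩
    funext i
    rw [hankel_mono, shift_apply]
    congr 2
  exact this hx

/-! ### Minimal realizations -/

section Realization

open Filter Topology

section Resolvent

attribute [local instance] Matrix.linftyOpNormedRing Matrix.linftyOpNormedAlgebra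

lemma tendsto_inv_smul_one_sub {ν : ℕ} (A : Matrix (Fin ν) (Fin ν) ℂ) :
    Tendsto (fun z : ℂ => (z • (1 : Matrix (Fin ν) (Fin ν) ℂ) - A)⁻¹) (Bornology.cobounded ℂ)
      (𝓝 0) := by
  convert spectrum.resolvent_tendsto_cobounded (𝕜 := ℂ) A using 2 with z
  · rw [nonsing_inv_eq_ringInverse, resolvent, Algebra.algebraMap_eq_smul_one]
  · rfl

lemma eventually_isUnit_det_cobounded {ν : ℕ} (A : Matrix (Fin ν) (Fin ν) ℂ) :
    ∀ᶠ z : ℂ in Bornology.cobounded ℂ, IsUnit (z • (1 : Matrix (Fin ν) (Fin ν) ℂ) - A).det := by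
  filter_upwards [Bornology.isBounded_def.1 (spectrum.isBounded (𝕜 := ℂ) A)] with z hz
  rw [← isUnit_iff_isUnit_det, ← Algebra.algebraMap_eq_smul_one]
  exact spectrum.notMem_iff.1 hz

end Resolvent

/-- The Markov parameters of a realization are `C A ^ k B`; they are recovered from the values of
`G` near infinity. -/
lemma IsRealization.markov {G : ℂ → Matrix (Fin p) (Fin m) ℂ} {ν : ℕ}
    {A : Matrix (Fin ν) (Fin ν) ℂ} {B : Matrix (Fin ν) (Fin m) ℂ} {C : Matrix (Fin p) (Fin ν) ℂ}
    (h : IsRealization G A B C) {M : ℕ → Matrix (Fin p) (Fin m) ℂ} {N : ℕ}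
    (hM : ∀ k, N ≤ k → M k = 0)
    (hG : ∀ z : ℂ, z ≠ 0 → G z = ∑ k ∈ Finset.range N, (z ^ (k + 1))⁻¹ • M k) (k : ℕ) :
    M k = C * A ^ k * B := by
  -- `S k` and `Q k` are the remainders of the expansions in `1 / z` of the two expressions for `G`,
  -- cut off after `k` terms and multiplied by `z ^ k`; both tend to zero at infinity
  let S : ℕ → ℂ → Matrix (Fin p) (Fin m) ℂ := fun k z =>
    ∑ i ∈ Finset.range N, (z ^ (i + 1))⁻¹ • M (k + i)
  let Q : ℕ → ℂ → Matrix (Fin p) (Fin m) ℂ := fun k z =>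
    C * A ^ k * (z • (1 : Matrix (Fin ν) (Fin ν) ℂ) - A)⁻¹ * B
  have hgood : ∀ᶠ z : ℂ in Bornology.cobounded ℂ,
      z ≠ 0 ∧ IsUnit (z • (1 : Matrix (Fin ν) (Fin ν) ℂ) - A).det :=
    (Bornology.eventually_ne_cobounded 0).and (eventually_isUnit_det_cobounded A)
  have hS0 : ∀ k, Tendsto (S k) (Bornology.cobounded ℂ) (𝓝 0) := by
    intro k
    rw [← Finset.sum_const_zero (s := Finset.range N)]
    refine tendsto_finsetSum _ fun i _ => ?_
    rw [← zero_smul ℂ (M (k + i))]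
    refine Tendsto.smul_const ?_ _
    have := (tendsto_inv₀_cobounded (α := ℂ)).pow (i + 1)
    simpa using this
  have hQ0 : ∀ k, Tendsto (Q k) (Bornology.cobounded ℂ) (𝓝 0) := by
    intro k
    have h1 : Continuous fun X : Matrix (Fin ν) (Fin ν) ℂ => C * A ^ k * X * B := by fun_prop
    have h2 := (h1.tendsto 0).comp (tendsto_inv_smul_one_sub A)
    simpa [Function.comp_def, Q] using h2
  have hS1 : ∀ k z, z ≠ 0 → z • S k z = M k + S (k + 1) z := by
    intro k z hz
    have h1 : z • S k z = ∑ i ∈ Finset.range N, (z ^ i)⁻¹ • M (k + i) := by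
      rw [Finset.smul_sum]
      refine Finset.sum_congr rfl fun i _ => ?_
      rw [smul_smul, pow_succ']
      congr 1
      field_simp
    have h2 : ∑ i ∈ Finset.range N, (z ^ i)⁻¹ • M (k + i) =
        ∑ i ∈ Finset.range (N + 1), (z ^ i)⁻¹ • M (k + i) := by
      rw [Finset.sum_range_succ, hM (k + N) (by omega), smul_zero, add_zero]
    rw [h1, h2, Finset.sum_range_succ', add_comm]
    simp [S, add_comm, add_left_comm]
  have hQ1 : ∀ k z, IsUnit (z • (1 : Matrix (Fin ν) (Fin ν) ℂ) - A).det →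
      z • Q k z = C * A ^ k * B + Q (k + 1) z := by
    intro k z hz
    have h1 := mul_nonsing_inv _ hz
    rw [sub_mul, smul_mul_assoc, one_mul, sub_eq_iff_eq_add] at h1
    calc z • Q k z
        = C * A ^ k * (z • (z • (1 : Matrix (Fin ν) (Fin ν) ℂ) - A)⁻¹) * B := by
          simp only [Q, Matrix.mul_smul, Matrix.smul_mul]
      _ = _ := by
          rw [h1]
          simp only [Q, pow_succ, Matrix.mul_add, Matrix.add_mul, Matrix.mul_one, Matrix.mul_assoc]
  have hstep : ∀ k, (∀ᶠ z in Bornology.cobounded ℂ, S k z = Q k z) → M k = C * A ^ k * B := by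
    intro k hk
    have h1 : Tendsto (fun z => M k + S (k + 1) z) (Bornology.cobounded ℂ) (𝓝 (M k + 0)) :=
      (hS0 _).const_add _
    have h2 : Tendsto (fun z => C * A ^ k * B + Q (k + 1) z) (Bornology.cobounded ℂ)
      (𝓝 (C * A ^ k * B + 0)) := (hQ0 _).const_add _
    rw [add_zero] at h1 h2
    refine tendsto_nhds_unique h1 (h2.congr' ?_)
    filter_upwards [hgood, hk] with z hz hkz
    rw [← hS1 k z hz.1, ← hQ1 k z hz.2, hkz]
  have hSQ : ∀ k, ∀ᶠ z in Bornology.cobounded ℂ, S k z = Q k z := by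
    intro k
    induction k with
    | zero =>
      filter_upwards [hgood] with z hz
      have := h z hz.1 hz.2
      rw [hG z hz.1] at this
      simpa [S, Q] using this
    | succ k ih =>
      filter_upwards [hgood, ih] with z hz hkz
      have h1 := hS1 k z hz.1
      rw [hkz, hQ1 k z hz.2, hstep k ih] at h1
      exact (add_left_cancel h1).symm
  exact hstep k (hSQ k)

/-- Kronecker's theorem: the minimal state space dimension of `G(z) = ∑ₖ z ^ (-k - 1) Pₖ₊₁`, with
`Pₖ` the coefficients of `P`, is the rank of the Hankel operator of `P`. -/
theorem minimalStateDim_eq_hankelRank (P : Matrix (Fin p) (Fin m) ℂ[T;T⁻¹])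
    (G : ℂ → Matrix (Fin p) (Fin m) ℂ)
    (hG : ∀ z : ℂ, z ≠ 0 → ∀ N : ℕ, (∀ n : ℤ, N ≤ n → coeffMat P n = 0) →
      G z = ∑ k ∈ Finset.range N, (z ^ (k + 1))⁻¹ • coeffMat P (k + 1)) :
    minimalStateDim G = hankelRank P := by
  obtain ⟨N, hN⟩ := exists_hankelRange_vanishing P
  have hN0 : ∀ n : ℤ, N ≤ n → coeffMat P n = 0 := fun n hn => (hN n hn).1
  have hr : hankelRank P ∈ {ν : ℕ | ∃ (A : Matrix (Fin ν) (Fin ν) ℂ) (B : Matrix (Fin ν) (Fin m) ℂ)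
    (C : Matrix (Fin p) (Fin ν) ℂ), IsRealization G A B C} := by
    let b : Module.Basis (Fin (hankelRank P)) ℂ (hankelRange P) := Module.finBasis ℂ _
    -- the shift realization on the range of the Hankel operator
    let a : hankelRange P →ₗ[ℂ] hankelRange P :=
      (shift p).restrict fun x hx => shift_mem_hankelRange P hx
    let β : (Fin m → ℂ) →ₗ[ℂ] hankelRange P :=
      { toFun := fun u => ⟨hankel P (mono u 0), Submodule.mem_map_of_mem (mono_mem_ker_tail u 0)⟩
        map_add' := fun u w => by
          ext1; funext i
          change hankel P _ i = hankel P _ i + hankel P _ i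
          simp only [hankel_mono, mulVec_add]
        map_smul' := fun c u => by
          ext1; funext i
          change hankel P _ i = c • hankel P _ i
          simp only [hankel_mono, mulVec_smul] }
    let γ : hankelRange P →ₗ[ℂ] (Fin p → ℂ) := LinearMap.proj 0 ∘ₗ (hankelRange P).subtype
    have ha : ∀ (k : ℕ) (x : hankelRange P) (i : ℕ), ((a ^ k) x).1 i = x.1 (i + k) := by
      intro k
      induction k with
      | zero => intro x i; rfl
      | succ k ih =>
        intro x i
        rw [pow_succ, Module.End.mul_apply, ih]
        change x.1 (i + k + 1) = _
        rfl
    have haN : a ^ N = 0 := by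
      ext1 x; ext1; funext i
      rw [ha]
      exact (hN N le_rfl).2 x x.2 _ (by omega)
    let A := LinearMap.toMatrix b b a
    let B := LinearMap.toMatrix (Pi.basisFun ℂ (Fin m)) b β
    let C := LinearMap.toMatrix b (Pi.basisFun ℂ (Fin p)) γ
    have hA : ∀ k, A ^ k = LinearMap.toMatrix b b (a ^ k) := fun k =>
      LinearMap.toMatrix_pow b a k
    have hCAB : ∀ k : ℕ, C * A ^ k * B = coeffMat P (k + 1) := by
      intro k
      rw [hA, ← LinearMap.toMatrix_comp, ← LinearMap.toMatrix_comp]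
      ext i j
      rw [LinearMap.toMatrix_apply, Pi.basisFun_repr, Pi.basisFun_apply]
      change ((a ^ k) (β (Pi.single j 1))).1 0 i = _
      rw [ha]
      change hankel P (mono (Pi.single j 1) 0) _ i = _
      rw [hankel_mono, mulVec_single_one]
      simp [add_comm]
    refine ⟨A, B, C, fun z hz _ => ?_⟩
    -- the Neumann series is finite, as the shift is nilpotent
    have hinv : (z • (1 : Matrix _ _ ℂ) - A)⁻¹ = ∑ k ∈ Finset.range N, (z ^ (k + 1))⁻¹ • A ^ k := by
      refine inv_eq_right_inv ?_
      have : ∀ n : ℕ, (z • (1 : Matrix _ _ ℂ) - A) * ∑ k ∈ Finset.range n, (z ^ (k + 1))⁻¹ • A ^ k =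
          1 - (z ^ n)⁻¹ • A ^ n := by
        intro n
        induction n with
        | zero => simp
        | succ n ih =>
          rw [Finset.sum_range_succ, mul_add, ih, sub_mul, smul_mul_smul_comm, one_mul,
            mul_smul_comm, ← pow_succ', show z * (z ^ (n + 1))⁻¹ = (z ^ n)⁻¹ by
              rw [pow_succ']; field_simp]
          abel
      rw [this, hA, haN, map_zero, smul_zero, sub_zero]
    rw [hG z hz N hN0, hinv, Matrix.mul_sum, Matrix.sum_mul]
    refine Finset.sum_congr rfl fun k _ => ?_
    rw [Matrix.mul_smul, Matrix.smul_mul, hCAB]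
  refine le_antisymm (Nat.sInf_le hr) (le_csInf ⟨_, hr⟩ ?_)
  rintro ν ⟨A, B, C, hreal⟩
  have hCAB := hreal.markov (M := fun k => coeffMat P (k + 1)) (N := N)
    (fun k hk => hN0 _ (by omega)) (fun z hz => hG z hz N hN0)
  -- the observability map of the realization covers the range of the Hankel operator
  let O : (Fin ν → ℂ) →ₗ[ℂ] (ℕ → Fin p → ℂ) := LinearMap.pi fun i => (C * A ^ i).mulVecLin
  have hle : hankelRange P ≤ LinearMap.range O := by
    refine hankelRange_le fun u n => ⟨(A ^ n * B) *ᵥ u, ?_⟩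
    funext i
    have := hCAB (i + n)
    push_cast at this
    rw [this]
    change (C * A ^ i) *ᵥ ((A ^ n * B) *ᵥ u) = _
    rw [mulVec_mulVec, pow_add]
    simp only [Matrix.mul_assoc]
  calc hankelRank P ≤ Module.finrank ℂ (LinearMap.range O) := Submodule.finrank_mono hle
    _ ≤ Module.finrank ℂ (Fin ν → ℂ) := LinearMap.finrank_range_le O
    _ = ν := by simp

end Realization

/-! ### Polynomials in `z` -/

/-- The Laurent polynomials without negative powers. -/
def nonneg : Subalgebra ℂ ℂ[T;T⁻¹] where
  carrier := {f | ∀ n : ℤ, n < 0 → f.coeff n = 0}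
  mul_mem' {f g} hf hg n hn := by
    replace hf : ∀ n : ℤ, n < 0 → f.coeff n = 0 := hf
    replace hg : ∀ n : ℤ, n < 0 → g.coeff n = 0 := hg
    have hexp : f * g = ∑ i ∈ g.coeff.support, f * (LaurentPolynomial.C (g.coeff i) * T i) := by
      rw [← Finset.mul_sum]
      congr 1
      ext l
      simp only [AddMonoidAlgebra.coeff_sum, Finsupp.coe_finsetSum, Finset.sum_apply,
        ← LaurentPolynomial.single_eq_C_mul_T, AddMonoidAlgebra.coeff_single, Finsupp.single_apply]
      rw [Finset.sum_ite_eq']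
      split_ifs with h
      · rfl
      · simpa using h
    rw [hexp, AddMonoidAlgebra.coeff_sum, Finsupp.coe_finsetSum, Finset.sum_apply]
    refine Finset.sum_eq_zero fun i _ => ?_
    rw [coeff_mul_C_mul_T]
    by_cases hi : i < 0
    · rw [hg i hi, mul_zero]
    · rw [hf _ (by omega), zero_mul]
  add_mem' {f g} hf hg n hn := by
    rw [AddMonoidAlgebra.coeff_add, Finsupp.add_apply, hf n hn, hg n hn, add_zero]
  algebraMap_mem' a n hn := by
    rw [← LaurentPolynomial.C_eq_algebraMap, LaurentPolynomial.C_apply, if_neg (by omega)]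

lemma mem_nonneg {f : ℂ[T;T⁻¹]} : f ∈ nonneg ↔ ∀ n : ℤ, n < 0 → f.coeff n = 0 := Iff.rfl

lemma C_mem_nonneg (a : ℂ) : LaurentPolynomial.C a ∈ nonneg := nonneg.algebraMap_mem a

lemma T_mem_nonneg {n : ℤ} (hn : 0 ≤ n) : (T n : ℂ[T;T⁻¹]) ∈ nonneg := fun l hl => by
  rw [LaurentPolynomial.T_apply, if_neg (by omega)]

lemma mem_ker_tail_iff_invert {y : Fin p → ℂ[T;T⁻¹]} :
    y ∈ LinearMap.ker (tail p) ↔ ∀ j, LaurentPolynomial.invert (y j) ∈ nonneg := by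
  simp only [mem_ker_tail, mem_nonneg, LaurentPolynomial.invert_apply]
  exact forall_congr' fun j => ⟨fun h n hn => h _ (by omega),
    fun h n hn => by simpa using h (-n) (by omega)⟩

lemma invert_mem_ker_tail {y : Fin p → ℂ[T;T⁻¹]} :
    (fun j => LaurentPolynomial.invert (y j)) ∈ LinearMap.ker (tail p) ↔ ∀ j, y j ∈ nonneg := by
  simp only [mem_ker_tail_iff_invert, LaurentPolynomial.involutive_invert _]

/-- The change of variable `z ↦ 1 / z`, which exchanges the poles at `0` and at infinity. -/
def mirror (P : Matrix (Fin p) (Fin m) ℂ[T;T⁻¹]) : Matrix (Fin p) (Fin m) ℂ[T;T⁻¹] :=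
  P.map (LaurentPolynomial.invert (R := ℂ))

lemma mirror_mul {k l n : ℕ} (P : Matrix (Fin k) (Fin l) ℂ[T;T⁻¹])
    (Q : Matrix (Fin l) (Fin n) ℂ[T;T⁻¹]) : mirror (P * Q) = mirror P * mirror Q :=
  Matrix.map_mul

lemma mirror_mirror (P : Matrix (Fin p) (Fin m) ℂ[T;T⁻¹]) : mirror (mirror P) = P := by
  ext1 i j
  exact LaurentPolynomial.involutive_invert _

lemma mirror_one : mirror (1 : Matrix (Fin p) (Fin p) ℂ[T;T⁻¹]) = 1 :=
  Matrix.map_one _ (map_zero _) (map_one _)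

lemma mirror_elemL (v : Fin p → ℂ) (c : ℂ[T;T⁻¹]) :
    mirror (elemL v c) = elemL v (LaurentPolynomial.invert c) := by
  ext1 i j
  simp [mirror, elemL, Matrix.one_apply, apply_ite (LaurentPolynomial.invert (R := ℂ))]

lemma mirror_mulVec (P : Matrix (Fin p) (Fin m) ℂ[T;T⁻¹]) (h : Fin m → ℂ[T;T⁻¹]) :
    mirror P *ᵥ (fun j => LaurentPolynomial.invert (h j)) =
      fun i => LaurentPolynomial.invert ((P *ᵥ h) i) := by
  ext1 i
  simp [mirror, mulVec, dotProduct]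

lemma para_mirror (P : Matrix (Fin p) (Fin m) ℂ[T;T⁻¹]) : para (mirror P) = mirror (para P) := by
  ext1 i j
  ext n
  simp [para, mirror, tilde_coeff]

lemma para_elemL (v : Fin p → ℂ) (c : ℂ[T;T⁻¹]) : para (elemL v c) = elemL v (tilde c) := by
  have hC : ∀ a : ℂ, tilde (LaurentPolynomial.C a) = LaurentPolynomial.C (star a) := by
    intro a
    ext n
    rw [tilde_coeff]
    simp only [LaurentPolynomial.C_apply, neg_eq_zero, apply_ite star, star_zero]
  ext1 i j
  simp only [para, elemL, Matrix.map_apply, transpose_apply, Matrix.add_apply, Matrix.one_apply,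
    Matrix.smul_apply, smul_eq_mul, map_add, map_mul, map_sub, map_one, hC, vecMulVec_apply,
    Pi.star_apply, star_star, apply_ite tilde, map_zero, eq_comm (a := j)]
  ring

lemma tilde_T (n : ℤ) : tilde (T n) = T (-n) := by
  ext l
  rw [tilde_coeff]
  simp only [LaurentPolynomial.T_apply, eq_neg_iff_add_eq_zero, neg_eq_iff_add_eq_zero,
    apply_ite star, star_zero, star_one]

lemma elemL_mulVec_apply {v : Fin p → ℂ} {c : ℂ[T;T⁻¹]} {y : Fin p → ℂ[T;T⁻¹]} (i : Fin p) :
    (elemL v c *ᵥ y) i = y i + (c - 1) * (LaurentPolynomial.C (v i) *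
      ∑ j, LaurentPolynomial.C (star (v j)) * y j) := by
  simp only [elemL, add_mulVec, one_mulVec, smul_mulVec, Pi.add_apply, Pi.smul_apply, smul_eq_mul]
  congr 2
  simp only [mulVec, dotProduct, Matrix.map_apply, vecMulVec_apply, Pi.star_apply, map_mul,
    Finset.mul_sum, mul_assoc]

/-! ### Splitting off an elementary factor -/

/-- The effect of the factor `I + (1 / z - 1) v v^*` on `tail`. -/
def shiftFactor (v : Fin p → ℂ) : (ℕ → Fin p → ℂ) →ₗ[ℂ] (ℕ → Fin p → ℂ) where
  toFun x := fun i => x i + (star v ⬝ᵥ (x (i + 1)) - star v ⬝ᵥ (x i)) • v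
  map_add' x y := by
    ext i j
    simp only [Pi.add_apply, dotProduct_add, Pi.smul_apply, smul_eq_mul]
    ring
  map_smul' a x := by
    ext i j
    simp only [Pi.add_apply, dotProduct_smul, Pi.smul_apply, smul_eq_mul, RingHom.id_apply]
    ring

lemma shiftFactor_apply (v : Fin p → ℂ) (x : ℕ → Fin p → ℂ) (i : ℕ) :
    shiftFactor v x i = x i + (star v ⬝ᵥ (x (i + 1)) - star v ⬝ᵥ (x i)) • v := rfl

lemma tail_elemL_mulVec (v : Fin p → ℂ) (y : Fin p → ℂ[T;T⁻¹]) :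
    tail p (elemL v (T (-1)) *ᵥ y) = shiftFactor v (tail p y) := by
  ext i j
  rw [tail_apply, elemL_mulVec_apply, shiftFactor_apply, sub_mul, one_mul,
    LaurentPolynomial.T_mul]
  simp only [AddMonoidAlgebra.coeff_add, AddMonoidAlgebra.coeff_sub, Finsupp.add_apply,
    Finsupp.sub_apply, coeff_mul_T, coeff_C_mul, AddMonoidAlgebra.coeff_sum, Finsupp.coe_finsetSum,
    Finset.sum_apply, Pi.add_apply, Pi.smul_apply, smul_eq_mul, dotProduct, tail_apply,
    Pi.star_apply, sub_neg_eq_add]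
  push_cast
  ring

lemma hankelRange_elemL_mul (v : Fin p → ℂ) (P : Matrix (Fin p) (Fin m) ℂ[T;T⁻¹]) :
    hankelRange (elemL v (T (-1)) * P) = (hankelRange P).map (shiftFactor v) := by
  rw [hankelRange, hankelRange, ← Submodule.map_comp]
  congr 1
  refine LinearMap.ext fun k => ?_
  rw [LinearMap.comp_apply, hankel_apply, hankel_apply, ← mulVec_mulVec, tail_elemL_mulVec]

/-- The kernel is spanned by the sequence `v, 0, 0, …`, which is the tail of `z v`. -/
lemma shiftFactor_eq_zero_iff {v : Fin p → ℂ} (hv : star v ⬝ᵥ v = 1) (x : ℕ → Fin p → ℂ) :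
    shiftFactor v x = 0 ↔ ∃ c : ℂ, x = Pi.single 0 (c • v) := by
  constructor
  · intro h
    have h1 : ∀ i, x i + (star v ⬝ᵥ (x (i + 1)) - star v ⬝ᵥ (x i)) • v = 0 := congrFun h
    have h2 : ∀ i, star v ⬝ᵥ x (i + 1) = 0 := by
      intro i
      have := congrArg (star v ⬝ᵥ ·) (h1 i)
      simpa [dotProduct_add, dotProduct_smul, hv] using this
    refine ⟨star v ⬝ᵥ x 0, funext fun i => ?_⟩
    cases i with
    | zero =>
      have := h1 0
      rw [h2, zero_sub, neg_smul, add_neg_eq_zero] at this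
      simpa using this
    | succ i =>
      have := h1 (i + 1)
      rw [h2, h2, sub_zero, zero_smul, add_zero] at this
      simpa using this
  · rintro ⟨c, rfl⟩
    funext i
    rw [shiftFactor_apply]
    cases i with
    | zero => simp [dotProduct_smul, hv]
    | succ i => simp

/-- By rank-nullity, the factor lowers the Hankel rank by the dimension of its kernel, which is the
line of `z v`. -/
lemma hankelRank_elemL_mul {P : Matrix (Fin p) (Fin m) ℂ[T;T⁻¹]} {v : Fin p → ℂ}
    (hv : star v ⬝ᵥ v = 1) (hvP : Pi.single 0 v ∈ hankelRange P) :
    hankelRank (elemL v (T (-1)) * P) + 1 = hankelRank P := by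
  have hrange : hankelRange (elemL v (T (-1)) * P) =
      LinearMap.range ((shiftFactor v).domRestrict (hankelRange P)) := by
    rw [hankelRange_elemL_mul, LinearMap.range_domRestrict]
  have hv0 : v ≠ 0 := by rintro rfl; simp at hv
  have hker : Module.finrank ℂ (LinearMap.ker ((shiftFactor v).domRestrict (hankelRange P))) = 1 := by
    have hmem : (⟨Pi.single 0 v, hvP⟩ : hankelRange P) ∈
        LinearMap.ker ((shiftFactor v).domRestrict (hankelRange P)) := by
      rw [LinearMap.mem_ker, LinearMap.domRestrict_apply, shiftFactor_eq_zero_iff hv]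
      exact ⟨1, by simp⟩
    refine finrank_eq_one
      (⟨_, hmem⟩ : LinearMap.ker ((shiftFactor v).domRestrict (hankelRange P))) ?_ ?_
    · intro h
      have h1 := congrArg (fun x => (x.1.1 : ℕ → Fin p → ℂ) 0) h
      exact hv0 (by simpa using h1)
    · rintro ⟨⟨x, hx⟩, hx0⟩
      rw [LinearMap.mem_ker, LinearMap.domRestrict_apply, shiftFactor_eq_zero_iff hv] at hx0
      obtain ⟨c, hc⟩ := hx0
      refine ⟨c, ?_⟩
      ext1; ext1
      change c • (Pi.single 0 v : ℕ → Fin p → ℂ) = x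
      rw [← Pi.single_smul]
      exact hc.symm
  have := LinearMap.finrank_range_add_finrank_ker ((shiftFactor v).domRestrict (hankelRange P))
  rw [hker] at this
  rw [hankelRank, hankelRank, hrange, this]

open scoped ComplexOrder in
lemma exists_single_mem_hankelRange {P : Matrix (Fin p) (Fin m) ℂ[T;T⁻¹]}
    (h : hankelRank P ≠ 0) :
    ∃ v : Fin p → ℂ, star v ⬝ᵥ v = 1 ∧ Pi.single 0 v ∈ hankelRange P := by
  obtain ⟨N, hN⟩ := exists_hankelRange_vanishing P
  have hne : hankelRange P ≠ ⊥ := fun h0 => h (by rw [hankelRank, h0, finrank_bot])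
  obtain ⟨x, hx, hx0⟩ := Submodule.exists_mem_ne_zero_of_ne_bot hne
  -- an element of minimal length is supported at the index `0`, by shift invariance
  have hex : ∃ l : ℕ, ∃ x ∈ hankelRange P, x ≠ 0 ∧ ∀ i : ℕ, l ≤ i → x i = 0 :=
    ⟨N, x, hx, hx0, fun i hi => (hN N le_rfl).2 x hx i hi⟩
  classical
  obtain ⟨y, hy, hy0, hyl⟩ := Nat.find_spec hex
  have hshift : shift p y = 0 := by
    by_contra hne
    have hl : 0 < Nat.find hex := by
      rcases Nat.eq_zero_or_pos (Nat.find hex) with h0 | h0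
      · exact absurd (funext fun i => hyl i (by omega)) hy0
      · exact h0
    refine Nat.find_min hex (m := Nat.find hex - 1) (by omega)
      ⟨_, shift_mem_hankelRange P hy, hne, fun i hi => ?_⟩
    rw [shift_apply]
    exact hyl _ (by omega)
  have hy1 : y = Pi.single 0 (y 0) := by
    funext i
    cases i with
    | zero => simp
    | succ i => simpa [shift_apply] using congrFun hshift i
  have hw0 : y 0 ≠ 0 := fun h0 => hy0 (by rw [hy1, h0, Pi.single_zero])
  obtain ⟨r, hr, hr0⟩ : ∃ r : ℝ, star (y 0) ⬝ᵥ y 0 = (r : ℂ) ∧ 0 < r := by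
    have h1 : 0 < star (y 0) ⬝ᵥ y 0 := dotProduct_star_self_pos_iff.2 hw0
    rw [Complex.pos_iff] at h1
    exact ⟨_, Complex.ext rfl (by simp [← h1.2]), h1.1⟩
  refine ⟨((√r)⁻¹ : ℂ) • y 0, ?_, ?_⟩
  · rw [star_smul, smul_dotProduct, dotProduct_smul, hr]
    have h2 : ((√r : ℝ) : ℂ) * (√r : ℝ) = r := by
      rw [← Complex.ofReal_mul, Real.mul_self_sqrt hr0.le]
    have h3 : ((√r : ℝ) : ℂ) ≠ 0 := by
      rw [Complex.ofReal_ne_zero]; positivity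
    simp only [star_inv₀, smul_eq_mul, Complex.star_def, Complex.conj_ofReal]
    rw [← h2]
    field_simp
  · rw [Pi.single_smul, ← hy1]
    exact Submodule.smul_mem _ _ hy

/-- If `z v` is, up to a polynomial in `1 / z`, in the image of the polynomials in `1 / z` under an
isometric `P`, then `v` is orthogonal to the constant terms of the polynomials `P h` in the image
of the polynomials. -/
lemma star_dotProduct_coeff_zero_eq_zero {P : Matrix (Fin p) (Fin m) ℂ[T;T⁻¹]}
    (hP : para P * P = 1) {v : Fin p → ℂ} (hvP : Pi.single 0 v ∈ hankelRange P)
    {h : Fin m → ℂ[T;T⁻¹]} (hh : ∀ j, h j ∈ nonneg) (hPh : ∀ i, (P *ᵥ h) i ∈ nonneg) :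
    ∑ i, star (v i) * ((P *ᵥ h) i).coeff 0 = 0 := by
  obtain ⟨k, hk, hkv⟩ := hvP
  rw [hankel_apply] at hkv
  set x := P *ᵥ k with hx
  set y := P *ᵥ h with hy
  -- the inner product of `P k` and `z P h`, computed by means of the isometry of `P`
  have hiso : ∑ i, tilde (x i) * y i = ∑ j, tilde (k j) * h j := by
    have h1 : (fun i => tilde (x i)) = (fun j => tilde (k j)) ᵥ* para P := by
      funext i
      simp [hx, mulVec, vecMul, dotProduct, para, mul_comm]
    change (fun i => tilde (x i)) ⬝ᵥ y = (fun j => tilde (k j)) ⬝ᵥ h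
    rw [h1, hy, ← dotProduct_mulVec, mulVec_mulVec, hP, one_mulVec]
  have hright : (∑ j, tilde (k j) * h j).coeff (-1) = 0 := by
    refine mem_nonneg.1 (Subalgebra.sum_mem _ fun j _ => nonneg.mul_mem ?_ (hh j)) _ (by omega)
    intro n hn
    rw [tilde_coeff, mem_ker_tail.1 hk j _ (by omega), star_zero]
  have hleft : ∀ i, (tilde (x i) * y i).coeff (-1) = star (v i) * (y i).coeff 0 := by
    intro i
    have hx1 : tilde (x i) - LaurentPolynomial.C (star (v i)) * T (-1) ∈ nonneg := by
      intro n hn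
      rw [AddMonoidAlgebra.coeff_sub, Finsupp.sub_apply, tilde_coeff,
        ← LaurentPolynomial.single_eq_C_mul_T, AddMonoidAlgebra.coeff_single, Finsupp.single_apply]
      obtain ⟨l, rfl⟩ : ∃ l : ℕ, n = -(l + 1) := ⟨(-n - 1).toNat, by omega⟩
      have h1 := congrFun (congrFun hkv l) i
      rw [tail_apply] at h1
      rw [neg_neg, h1]
      cases l with
      | zero => simp
      | succ l => simp; omega
    have h2 := mem_nonneg.1 (nonneg.mul_mem hx1 (hPh i)) (-1) (by omega)
    rw [sub_mul, AddMonoidAlgebra.coeff_sub, Finsupp.sub_apply, sub_eq_zero] at h2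
    rw [h2, mul_assoc, coeff_C_mul, LaurentPolynomial.T_mul, coeff_mul_T]
    simp
  rw [← hiso, AddMonoidAlgebra.coeff_sum, Finsupp.coe_finsetSum, Finset.sum_apply] at hright
  rw [← hright]
  exact Finset.sum_congr rfl fun i _ => (hleft i).symm

lemma finrank_map_eq_of_ker_eq {V W : Type*} [AddCommGroup V] [Module ℂ V] [AddCommGroup W]
    [Module ℂ W] {f g : V →ₗ[ℂ] W} {S : Submodule ℂ V} (h : ∀ x ∈ S, f x = 0 ↔ g x = 0) :
    Module.finrank ℂ (S.map f) = Module.finrank ℂ (S.map g) := by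
  have hker : LinearMap.ker (f.domRestrict S) = LinearMap.ker (g.domRestrict S) := by
    ext x
    exact h x x.2
  rw [← LinearMap.range_domRestrict, ← LinearMap.range_domRestrict]
  exact (((f.domRestrict S).quotKerEquivRange.symm.trans
    (Submodule.quotEquivOfEq _ _ hker)).trans (g.domRestrict S).quotKerEquivRange).finrank_eq

/-- The Hankel rank at zero is determined by the set of polynomials `h` for which `P h` is
polynomial; this set does not change under the factor `I + (1 / z - 1) v v^*`. -/
lemma hankelRank_mirror_elemL_mul {P : Matrix (Fin p) (Fin m) ℂ[T;T⁻¹]} (hP : para P * P = 1)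
    {v : Fin p → ℂ} (hv : star v ⬝ᵥ v = 1) (hvP : Pi.single 0 v ∈ hankelRange P) :
    hankelRank (mirror (elemL v (T (-1)) * P)) = hankelRank (mirror P) := by
  refine finrank_map_eq_of_ker_eq fun k hk => ?_
  obtain ⟨h, rfl⟩ : ∃ h : Fin m → ℂ[T;T⁻¹], k = fun j => LaurentPolynomial.invert (h j) :=
    ⟨fun j => LaurentPolynomial.invert (k j), by simp [LaurentPolynomial.involutive_invert _]⟩
  rw [invert_mem_ker_tail] at hk
  rw [hankel_apply, hankel_apply, mirror_mulVec, mirror_mulVec, ← LinearMap.mem_ker,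
    ← LinearMap.mem_ker, invert_mem_ker_tail, invert_mem_ker_tail, ← mulVec_mulVec]
  constructor
  · intro hE i
    have h1 : P *ᵥ h = elemL v (T 1) *ᵥ (elemL v (T (-1)) *ᵥ (P *ᵥ h)) := by
      rw [mulVec_mulVec, elemL_mul hv, ← LaurentPolynomial.T_add]
      simp [elemL_one]
    rw [h1, elemL_mulVec_apply]
    refine nonneg.add_mem (hE i) (nonneg.mul_mem
      (nonneg.sub_mem (T_mem_nonneg (by norm_num)) nonneg.one_mem) (nonneg.mul_mem (C_mem_nonneg _)
      (Subalgebra.sum_mem _ fun j _ => nonneg.mul_mem (C_mem_nonneg _) (hE j))))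
  · intro hPh i
    -- `s = v^* P h` has no constant term, so that `s / z` is still a polynomial
    set s := ∑ j, LaurentPolynomial.C (star (v j)) * (P *ᵥ h) j with hs
    have hsn : s ∈ nonneg :=
      Subalgebra.sum_mem _ fun j _ => nonneg.mul_mem (C_mem_nonneg _) (hPh j)
    have hs0 : s.coeff 0 = 0 := by
      have := star_dotProduct_coeff_zero_eq_zero hP hvP hk hPh
      rw [hs, AddMonoidAlgebra.coeff_sum, Finsupp.coe_finsetSum, Finset.sum_apply]
      simpa only [coeff_C_mul] using this
    have hTs : s * T (-1) ∈ nonneg := by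
      intro n hn
      rw [coeff_mul_T]
      rcases (show n - -1 < 0 ∨ n - -1 = 0 by omega) with h1 | h1
      · exact hsn _ h1
      · rw [h1, hs0]
    rw [elemL_mulVec_apply, ← hs,
      show (T (-1) - 1) * (LaurentPolynomial.C (v i) * s) =
        LaurentPolynomial.C (v i) * (s * T (-1) - s) by ring]
    exact nonneg.add_mem (hPh i) (nonneg.mul_mem (C_mem_nonneg _) (nonneg.sub_mem hTs hsn))

/-! ### The factorization -/

lemma para_mul_self_elemL_mul {P : Matrix (Fin p) (Fin m) ℂ[T;T⁻¹]} (hP : para P * P = 1)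
    {v : Fin p → ℂ} (hv : star v ⬝ᵥ v = 1) (n : ℤ) :
    para (elemL v (T n) * P) * (elemL v (T n) * P) = 1 := by
  rw [para_mul, Matrix.mul_assoc, ← Matrix.mul_assoc _ _ P, para_elemL, elemL_mul hv, tilde_T,
    ← LaurentPolynomial.T_add]
  simp [elemL_one, hP]

/-- Splitting off all factors `I + (z - 1) v v^*`. -/
lemma exists_list_hankelRank_eq_zero (n : ℕ) (P : Matrix (Fin p) (Fin m) ℂ[T;T⁻¹])
    (hP : para P * P = 1) (hn : hankelRank P = n) :
    ∃ (l : List (Fin p → ℂ)) (Q : Matrix (Fin p) (Fin m) ℂ[T;T⁻¹]),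
      l.length = n ∧ (∀ v ∈ l, star v ⬝ᵥ v = 1) ∧ para Q * Q = 1 ∧ hankelRank Q = 0 ∧
      hankelRank (mirror Q) = hankelRank (mirror P) ∧
      P = (l.map fun v => elemL v (T 1)).prod * Q := by
  induction n generalizing P with
  | zero => exact ⟨[], P, rfl, by simp, hP, hn, rfl, by simp⟩
  | succ n ih =>
    obtain ⟨v, hv, hvP⟩ := exists_single_mem_hankelRange (P := P) (by omega)
    have h1 := hankelRank_elemL_mul hv hvP
    obtain ⟨l, Q, hl, hlv, hQ, hQ0, hQm, hPQ⟩ := ih (elemL v (T (-1)) * P)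
      (para_mul_self_elemL_mul hP hv _) (by omega)
    refine ⟨v :: l, Q, by simp [hl], by simpa [hv] using hlv, hQ, hQ0, ?_, ?_⟩
    · rw [hQm, hankelRank_mirror_elemL_mul hP hv hvP]
    · rw [List.map_cons, List.prod_cons, Matrix.mul_assoc, ← hPQ, ← Matrix.mul_assoc, elemL_mul hv,
        ← LaurentPolynomial.T_add]
      simp [elemL_one]

lemma coeff_eq_zero_of_hankelRank_eq_zero {P : Matrix (Fin p) (Fin m) ℂ[T;T⁻¹]}
    (h : hankelRank P = 0) (i : Fin p) (j : Fin m) (n : ℤ) (hn : 0 < n) : (P i j).coeff n = 0 := by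
  have h1 : hankelRange P = ⊥ := Submodule.finrank_eq_zero.1 h
  have h2 : hankel P (mono (Pi.single j 1) (-(0 : ℕ))) ∈ hankelRange P :=
    Submodule.mem_map_of_mem (mono_mem_ker_tail _ 0)
  rw [h1, Submodule.mem_bot] at h2
  have h3 := congrFun (congrFun h2 (n - 1).toNat) i
  rw [hankel_mono, mulVec_single_one] at h3
  have h4 : ((n - 1).toNat : ℤ) + 1 - -((0 : ℕ) : ℤ) = n := by omega
  rw [h4] at h3
  exact h3

/-- An isometric matrix of Laurent polynomials is a product of as many elementary factors as
its McMillan degree, and of a constant isometry. -/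
theorem exists_factorization (P : Matrix (Fin p) (Fin m) ℂ[T;T⁻¹]) (hP : para P * P = 1) :
    ∃ (l₁ l₂ : List (Fin p → ℂ)) (U : Matrix (Fin p) (Fin m) ℂ),
      l₁.length = hankelRank P ∧ l₂.length = hankelRank (mirror P) ∧
      (∀ v ∈ l₁, star v ⬝ᵥ v = 1) ∧ (∀ v ∈ l₂, star v ⬝ᵥ v = 1) ∧ Uᴴ * U = 1 ∧
      P = (l₁.map fun v => elemL v (T 1)).prod * (l₂.map fun v => elemL v (T (-1))).prod *
        U.map LaurentPolynomial.C := by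
  obtain ⟨l₁, Q, hl₁, hlv₁, hQ, hQ0, hQm, hPQ⟩ := exists_list_hankelRank_eq_zero _ P hP rfl
  obtain ⟨l₂, S, hl₂, hlv₂, hS, hS0, hSm, hQS⟩ := exists_list_hankelRank_eq_zero _ (mirror Q)
    (by rw [para_mirror, ← mirror_mul, hQ, mirror_one]) rfl
  rw [mirror_mirror, hQ0] at hSm
  have hSU : S = (coeffMat S 0).map LaurentPolynomial.C := by
    ext i j n
    rw [Matrix.map_apply, LaurentPolynomial.C_apply]
    rcases lt_trichotomy n 0 with h | h | h
    · have := coeff_eq_zero_of_hankelRank_eq_zero hSm i j (-n) (by omega)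
      rw [if_neg h.ne]
      simpa [mirror] using this
    · rw [if_pos h, h]; rfl
    · rw [if_neg h.ne', coeff_eq_zero_of_hankelRank_eq_zero hS0 i j n h]
  have hprod : mirror (l₂.map fun v => elemL v (T 1)).prod =
      (l₂.map fun v => elemL v (T (-1))).prod := by
    clear hl₂ hlv₂ hQS
    induction l₂ with
    | nil => simp [mirror_one]
    | cons v l ih => simp [mirror_mul, ih, mirror_elemL]
  have hmS : mirror S = (coeffMat S 0).map LaurentPolynomial.C := by
    conv_lhs => rw [hSU]
    ext1 i j
    simp [mirror]
  refine ⟨l₁, l₂, coeffMat S 0, hl₁, hl₂.trans hQm, hlv₁, hlv₂, ?_, ?_⟩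
  · have h1 := congrArg (fun M => Matrix.map M (evalAt 1)) hS
    simp only [Matrix.map_mul] at h1
    rw [map_evalAt_para _ _ (by simp), Matrix.map_one _ (map_zero _) (map_one _), hSU] at h1
    convert h1 using 2
    · ext i j; simp [evalAt_C]
    · ext i j; simp [evalAt_C]
  · rw [Matrix.mul_assoc, ← hmS, ← hprod, ← mirror_mul, ← hQS, mirror_mirror]
    exact hPQ

/-! ### The McMillan degree -/

lemma eval_eq_sum_range (F : FIR p m) (e : ℕ → ℤ) (he : Function.Injective e) (N : ℕ)
    (hF : ∀ n, F n ≠ 0 → ∃ k < N, e k = n) (z : ℂ) :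
    F.eval z = ∑ k ∈ Finset.range N, z ^ e k • F (e k) := by
  rw [eval, Finsupp.sum_of_support_subset F (s := (Finset.range N).image e) _ _ (by simp),
    Finset.sum_image he.injOn]
  intro n hn
  obtain ⟨k, hk, rfl⟩ := hF n (Finsupp.mem_support_iff.1 hn)
  exact Finset.mem_image_of_mem _ (Finset.mem_range.2 hk)

lemma mcMillanDegree_eq (F : FIR p m) :
    F.mcMillanDegree = hankelRank F.toLaurent + hankelRank (mirror F.toLaurent) := by
  rw [mcMillanDegree, add_comm]
  congr 1
  · refine minimalStateDim_eq_hankelRank _ _ fun z hz N hN => ?_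
    replace hN : ∀ n : ℤ, N ≤ n → F n = 0 := hN
    rw [eval_eq_sum_range _ (fun k => (k : ℤ) + 1) (fun a b h => by simpa using h) N]
    · refine Finset.sum_congr rfl fun k _ => ?_
      rw [leftPart, Finsupp.filter_apply_pos _ _ (by positivity)]
      congr 1
      rw [_root_.inv_zpow]
      norm_cast
    · intro n hn
      rw [leftPart, Finsupp.filter_apply] at hn
      split_ifs at hn with h
      · have : ¬ (N : ℤ) ≤ n := fun h' => hn (hN n h')
        exact ⟨(n - 1).toNat, by omega, by omega⟩
      · exact absurd rfl hn
  · refine minimalStateDim_eq_hankelRank _ _ fun z hz N hN => ?_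
    have hco : ∀ n : ℤ, coeffMat (mirror F.toLaurent) n = F (-n) := by
      intro n
      ext i j
      simp [coeffMat, mirror, toLaurent_coeff]
    simp only [hco] at hN ⊢
    rw [eval_eq_sum_range _ (fun k => -((k : ℤ) + 1)) (fun a b h => by simpa using h) N]
    · refine Finset.sum_congr rfl fun k _ => ?_
      rw [rightPart, Finsupp.filter_apply_pos _ _ (by omega)]
      congr 1
    · intro n hn
      rw [rightPart, Finsupp.filter_apply] at hn
      split_ifs at hn with h
      · have : ¬ (N : ℤ) ≤ -n := fun h' => hn (by simpa using hN (-n) h')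
        exact ⟨(-n - 1).toNat, by omega, by omega⟩
      · exact absurd rfl hn

/-! ### Duality -/

/-- The function `z ↦ F(conj z)^*`, with the coefficients `Bₖ^*`. -/
def dual (F : FIR p m) : FIR m p := F.mapRange conjTranspose (conjTranspose_zero)

lemma dual_apply (F : FIR p m) (k : ℤ) : F.dual k = (F k)ᴴ := rfl

lemma dual_dual (F : FIR p m) : F.dual.dual = F := by
  ext1 k
  rw [dual_apply, dual_apply, conjTranspose_conjTranspose]

lemma eval_dual (F : FIR p m) (z : ℂ) : F.dual.eval z = (F.eval (star z))ᴴ := by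
  rw [dual, eval, Finsupp.sum_mapRange_index (by simp), eval, Finsupp.sum, Finsupp.sum,
    conjTranspose_sum]
  refine Finset.sum_congr rfl fun k _ => ?_
  simp

lemma IsRealization.dual {G : ℂ → Matrix (Fin p) (Fin m) ℂ} {ν : ℕ}
    {A : Matrix (Fin ν) (Fin ν) ℂ} {B : Matrix (Fin ν) (Fin m) ℂ} {C : Matrix (Fin p) (Fin ν) ℂ}
    (h : IsRealization G A B C) : IsRealization (fun z => (G (star z))ᴴ) Aᴴ Cᴴ Bᴴ := by
  intro z hz hdet
  have h1 : z • (1 : Matrix (Fin ν) (Fin ν) ℂ) - Aᴴ =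
      (star z • (1 : Matrix (Fin ν) (Fin ν) ℂ) - A)ᴴ := by
    simp
  rw [h1, det_conjTranspose] at hdet
  change (G (star z))ᴴ = _
  rw [h (star z) (star_ne_zero.2 hz) (isUnit_star.1 hdet), h1, conjTranspose_mul,
    conjTranspose_mul, conjTranspose_nonsing_inv, Matrix.mul_assoc]

lemma minimalStateDim_dual (G : ℂ → Matrix (Fin p) (Fin m) ℂ) :
    minimalStateDim (fun z => (G (star z))ᴴ) = minimalStateDim G := by
  unfold minimalStateDim
  congr 1
  ext ν
  constructor
  · rintro ⟨A, B, C, h⟩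
    exact ⟨Aᴴ, Cᴴ, Bᴴ, by simpa using h.dual⟩
  · rintro ⟨A, B, C, h⟩
    exact ⟨Aᴴ, Cᴴ, Bᴴ, h.dual⟩

lemma mcMillanDegree_dual (F : FIR p m) : F.dual.mcMillanDegree = F.mcMillanDegree := by
  have hr : F.dual.rightPart = F.rightPart.dual := by
    ext1 k
    simp only [rightPart, dual_apply, Finsupp.filter_apply]
    split_ifs <;> simp
  have hl : F.dual.leftPart = F.leftPart.dual := by
    ext1 k
    simp only [leftPart, dual_apply, Finsupp.filter_apply]
    split_ifs <;> simp
  rw [mcMillanDegree, mcMillanDegree, hr, hl,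
    ← minimalStateDim_dual (fun z => F.rightPart.eval z),
    ← minimalStateDim_dual (fun w => F.leftPart.eval w⁻¹)]
  simp only [eval_dual, star_inv₀]

/-! ### Products of elementary factors -/

lemma map_evalAt_list_prod {k : ℕ} (l : List (Fin k → ℂ)) (c : ℂ[T;T⁻¹]) (z : ℂˣ) :
    (l.map fun v => elemL v c).prod.map (evalAt z) =
      (l.map fun v => elemFactor v (evalAt z c)).prod := by
  rw [← RingHom.mapMatrix_apply, map_list_prod, List.map_map]
  congr 2
  funext v
  exact map_evalAt_elemL v c z

lemma map_C_map_evalAt (U : Matrix (Fin p) (Fin m) ℂ) (z : ℂˣ) :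
    (U.map LaurentPolynomial.C).map (evalAt z) = U := by
  ext i j
  simp [evalAt_C]

lemma exists_lists_of_isIsometric {F : FIR p m} (hF : F.IsIsometric) :
    ∃ (l₁ l₂ : List (Fin p → ℂ)) (U : Matrix (Fin p) (Fin m) ℂ),
      l₁.length + l₂.length = F.mcMillanDegree ∧ (∀ v ∈ l₁ ++ l₂, star v ⬝ᵥ v = 1) ∧
      Uᴴ * U = 1 ∧ ∀ z : ℂ, z ≠ 0 → F.eval z = (l₁.map fun v => elemFactor v z).prod *
        (l₂.map fun v => elemFactor v (1 / z)).prod * U := by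
  obtain ⟨l₁, l₂, U, hl₁, hl₂, hv₁, hv₂, hU, hFU⟩ :=
    exists_factorization _ (para_mul_self_of_isIsometric hF)
  refine ⟨l₁, l₂, U, by rw [hl₁, hl₂, mcMillanDegree_eq], ?_, hU, fun z hz => ?_⟩
  · intro v hv
    exact (List.mem_append.1 hv).elim (hv₁ v) (hv₂ v)
  · have := map_evalAt_toLaurent F (Units.mk0 z hz)
    rw [hFU, Matrix.map_mul, Matrix.map_mul, map_evalAt_list_prod, map_evalAt_list_prod,
      map_C_map_evalAt] at this
    simpa [evalAt_T] using this.symm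

lemma conjTranspose_list_prod_elemFactor {k : ℕ} (l : List (Fin k → ℂ)) (c : ℂ) :
    (l.map fun v => elemFactor v c).prodᴴ = (l.reverse.map fun v => elemFactor v (star c)).prod := by
  rw [conjTranspose_list_prod, List.map_map, ← List.map_reverse]
  congr 2
  funext v
  exact conjTranspose_elemFactor v c

lemma exists_lists_of_isCoisometric {F : FIR p m} (hF : F.IsCoisometric) :
    ∃ (l₁ l₂ : List (Fin m → ℂ)) (U : Matrix (Fin p) (Fin m) ℂ),
      l₁.length + l₂.length = F.mcMillanDegree ∧ (∀ v ∈ l₁ ++ l₂, star v ⬝ᵥ v = 1) ∧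
      U * Uᴴ = 1 ∧ ∀ z : ℂ, z ≠ 0 → F.eval z = U * (l₂.map fun v => elemFactor v (1 / z)).prod *
        (l₁.map fun v => elemFactor v z).prod := by
  have hF' : F.dual.IsIsometric := fun z hz => by
    rw [eval_dual, conjTranspose_conjTranspose]
    exact hF _ (by simpa using hz)
  obtain ⟨l₁, l₂, U, hl, hv, hU, hFU⟩ := exists_lists_of_isIsometric hF'
  refine ⟨l₁.reverse, l₂.reverse, Uᴴ, by simp [hl, mcMillanDegree_dual], ?_, by simpa using hU,
    fun z hz => ?_⟩
  · intro v hv'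
    exact hv v (by simpa using hv')
  · rw [← dual_dual F, eval_dual, hFU _ (star_ne_zero.2 hz), conjTranspose_mul, conjTranspose_mul,
      conjTranspose_list_prod_elemFactor, conjTranspose_list_prod_elemFactor, Matrix.mul_assoc]
    simp

/-- Lists of vectors as sequences indexed from `1`. -/
def listSeq {k : ℕ} (l : List (Fin k → ℂ)) (j : ℕ) : Fin k → ℂ := l.getD (j - 1) 0

lemma prodAsc_listSeq_left {k : ℕ} (l₁ l₂ : List (Fin k → ℂ)) (c : ℂ) :
    prodAsc 1 l₁.length (fun j => elemFactor (listSeq (l₁ ++ l₂) j) c) =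
      (l₁.map fun v => elemFactor v c).prod := by
  unfold prodAsc
  congr 1
  refine List.ext_getElem (by simp) fun i h1 h2 => ?_
  simp only [List.length_map] at h2
  simp [listSeq, List.getElem?_append_left h2, h2]

lemma prodAsc_listSeq_right {k : ℕ} (l₁ l₂ : List (Fin k → ℂ)) (c : ℂ) :
    prodAsc (l₁.length + 1) (l₁.length + l₂.length)
      (fun j => elemFactor (listSeq (l₁ ++ l₂) j) c) = (l₂.map fun v => elemFactor v c).prod := by
  unfold prodAsc
  congr 1
  refine List.ext_getElem (by simp) fun i h1 h2 => ?_
  simp only [List.length_map] at h2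
  have h3 : l₁.length + 1 + i - 1 = l₁.length + i := by omega
  simp [listSeq, h3, h2]

lemma admissible_listSeq {k : ℕ} {l₁ l₂ : List (Fin k → ℂ)}
    (h : ∀ v ∈ l₁ ++ l₂, star v ⬝ᵥ v = 1) :
    Admissible (l₁.length + l₂.length) l₁.length (listSeq (l₁ ++ l₂)) := by
  refine ⟨by omega, fun j hj1 hj2 => h _ ?_⟩
  have : j - 1 < (l₁ ++ l₂).length := by simp; omega
  rw [listSeq, List.getD_eq_getElem _ _ this]
  exact List.getElem_mem this

lemma inv_prodDesc {k : ℕ} {a b : ℕ} {v : ℕ → Fin k → ℂ}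
    (hv : ∀ j, a ≤ j → j ≤ b → star (v j) ⬝ᵥ v j = 1) {c : ℂ} (hc : c ≠ 0) :
    (prodDesc b a fun j => elemFactor (v j) c)⁻¹ = prodAsc a b fun j => elemFactor (v j) (1 / c) := by
  rw [prodDesc, prodAsc, list_prod_inv_reverse, ← List.map_reverse, List.reverse_reverse,
    List.map_map]
  congr 1
  refine List.map_congr_left fun j hj => ?_
  rw [List.mem_range'_1] at hj
  refine inv_eq_right_inv ?_
  rw [elemFactor_mul (hv j hj.1 (by omega)), mul_one_div_cancel hc, elemFactor_one]

lemma prodAsc_mem_unitary {k : ℕ} {a b : ℕ} {v : ℕ → Fin k → ℂ}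
    (hv : ∀ j, a ≤ j → j ≤ b → star (v j) ⬝ᵥ v j = 1) {c : ℂ} (hc : ‖c‖ = 1) :
    (prodAsc a b fun j => elemFactor (v j) c) ∈ unitaryGroup (Fin k) ℂ := by
  refine Submonoid.list_prod_mem _ fun M hM => ?_
  obtain ⟨j, hj, rfl⟩ := List.mem_map.1 hM
  rw [List.mem_range'_1] at hj
  rw [mem_unitaryGroup_iff, star_eq_conjTranspose, conjTranspose_elemFactor,
    elemFactor_mul (hv j hj.1 (by omega)), Complex.star_def, Complex.mul_conj, Complex.normSq_eq_norm_sq,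
    hc]
  simp [elemFactor_one]

lemma mul_apply_mem {k l n : ℕ} (S : Subalgebra ℂ ℂ[T;T⁻¹]) {P : Matrix (Fin k) (Fin l) ℂ[T;T⁻¹]}
    {Q : Matrix (Fin l) (Fin n) ℂ[T;T⁻¹]} (hP : ∀ i j, P i j ∈ S) (hQ : ∀ i j, Q i j ∈ S)
    (i : Fin k) (j : Fin n) : (P * Q) i j ∈ S := by
  rw [Matrix.mul_apply]
  exact S.sum_mem fun t _ => S.mul_mem (hP _ _) (hQ _ _)

lemma list_prod_elemL_apply_mem {k : ℕ} (S : Subalgebra ℂ ℂ[T;T⁻¹]) {c : ℂ[T;T⁻¹]} (hc : c ∈ S)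
    (l : List (Fin k → ℂ)) (i j : Fin k) : (l.map fun v => elemL v c).prod i j ∈ S := by
  have h1 : ∀ i j, (1 : Matrix (Fin k) (Fin k) ℂ[T;T⁻¹]) i j ∈ S := fun i j => by
    rw [Matrix.one_apply]
    split_ifs
    exacts [S.one_mem, S.zero_mem]
  induction l generalizing i j with
  | nil => exact h1 i j
  | cons v l ih =>
    rw [List.map_cons, List.prod_cons]
    refine mul_apply_mem S (fun i j => ?_) ih i j
    rw [elemL, Matrix.add_apply, Matrix.smul_apply, smul_eq_mul]
    exact S.add_mem (h1 i j) (S.mul_mem (S.sub_mem hc S.one_mem) (S.algebraMap_mem _))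

/-- A product of elementary factors and constant matrices, all in the same variable `c`, has its
entries in every subalgebra that contains `c`. -/
lemma toLaurent_apply_mem {q : ℕ} (S : Subalgebra ℂ ℂ[T;T⁻¹]) {c : ℂ[T;T⁻¹]} (hc : c ∈ S)
    {F : FIR p m} {U : Matrix (Fin p) (Fin q) ℂ} {V : Matrix (Fin q) (Fin m) ℂ}
    {a b : ℕ} {v : ℕ → Fin q → ℂ}
    (h : ∀ z : ℂˣ, F.eval z = U * (prodAsc a b fun j => elemFactor (v j) (evalAt z c)) * V)
    (i : Fin p) (j : Fin m) : F.toLaurent i j ∈ S := by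
  have hF : F.toLaurent = U.map LaurentPolynomial.C *
      (((List.range' a (b + 1 - a)).map v).map fun v => elemL v c).prod *
        V.map LaurentPolynomial.C := by
    refine ext_of_evalAt fun z _ => ?_
    rw [map_evalAt_toLaurent, h, Matrix.map_mul, Matrix.map_mul, map_evalAt_list_prod,
      map_C_map_evalAt, map_C_map_evalAt, List.map_map]
    rfl
  rw [hF]
  exact mul_apply_mem S (mul_apply_mem S (fun _ _ => S.algebraMap_mem _)
    (list_prod_elemL_apply_mem S hc _)) (fun _ _ => S.algebraMap_mem _) i j

lemma isAntiCausal_of_eval {q : ℕ} {F : FIR p m} {U : Matrix (Fin p) (Fin q) ℂ}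
    {V : Matrix (Fin q) (Fin m) ℂ} {a b : ℕ} {v : ℕ → Fin q → ℂ}
    (h : ∀ z : ℂ, z ≠ 0 → F.eval z = U * (prodAsc a b fun j => elemFactor (v j) z) * V) :
    F.IsAntiCausal := by
  intro k hk
  ext i j
  refine mem_nonneg.1 (toLaurent_apply_mem nonneg (T_mem_nonneg zero_le_one) (U := U) (V := V)
    (a := a) (b := b) (v := v) (fun z => ?_) i j) k hk
  rw [h z z.ne_zero, evalAt_T, zpow_one]

lemma isCausal_of_eval {q : ℕ} {F : FIR p m} {U : Matrix (Fin p) (Fin q) ℂ}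
    {V : Matrix (Fin q) (Fin m) ℂ} {a b : ℕ} {v : ℕ → Fin q → ℂ}
    (h : ∀ z : ℂ, z ≠ 0 → F.eval z = U * (prodAsc a b fun j => elemFactor (v j) (1 / z)) * V) :
    F.IsCausal := by
  intro k hk
  ext i j
  have hT : T (-1) ∈ nonneg.comap (LaurentPolynomial.invert (R := ℂ)).toAlgHom := by
    change LaurentPolynomial.invert (T (-1)) ∈ nonneg
    rw [LaurentPolynomial.invert_T]
    exact T_mem_nonneg (by norm_num)
  have h1 := toLaurent_apply_mem _ hT (F := F) (U := U) (V := V) (a := a) (b := b) (v := v)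
    (fun z => by rw [h z z.ne_zero, evalAt_T, _root_.zpow_neg_one, one_div]) i j
  have h2 : (LaurentPolynomial.invert (F.toLaurent i j)).coeff (-k) = 0 := h1 (-k) (by omega)
  simpa [toLaurent_coeff] using h2

lemma prodAsc_of_lt {k a b : ℕ} (h : b < a) (M : ℕ → Matrix (Fin k) (Fin k) ℂ) :
    prodAsc a b M = 1 := by
  rw [prodAsc, show b + 1 - a = 0 by omega]
  rfl

/-! ### The isometric forms -/

lemma isoForm₁_iff_isoForm₂ {F : FIR p m} {d γ : ℕ} {v : ℕ → Fin p → ℂ}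
    (hv : Admissible d γ v) (U : Matrix (Fin p) (Fin m) ℂ) :
    F.IsoForm₁ d γ v U ↔ F.IsoForm₂ d γ v U := by
  refine forall₂_congr fun z hz => ?_
  rw [inv_prodDesc (fun j h1 h2 => hv.2 j (by omega) h2) hz]

lemma isoForm₁_iff_isoForm₃ {F : FIR p m} {d γ : ℕ} {v : ℕ → Fin p → ℂ}
    (hv : Admissible d γ v) (U : Matrix (Fin p) (Fin m) ℂ) :
    F.IsoForm₁ d γ v U ↔ F.IsoForm₃ d γ v U := by
  refine forall₂_congr fun z hz => ?_
  rw [inv_prodDesc (fun j h1 h2 => hv.2 j h1 (h2.trans hv.1)) (one_div_ne_zero hz), one_div_one_div]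

lemma IsoForm₁.isIsometric {F : FIR p m} {d γ : ℕ} {v : ℕ → Fin p → ℂ} (hv : Admissible d γ v)
    {U : Matrix (Fin p) (Fin m) ℂ} (hU : Uᴴ * U = 1) (h : F.IsoForm₁ d γ v U) :
    F.IsIsometric := by
  intro z hz
  have hz0 : z ≠ 0 := by rintro rfl; simp at hz
  have h1 := mul_mem (prodAsc_mem_unitary (fun j h1 h2 => hv.2 j h1 (h2.trans hv.1)) hz)
    (prodAsc_mem_unitary (c := 1 / z) (a := γ + 1) (fun j h1 h2 => hv.2 j (by omega) h2)
      (by simp [hz]))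
  rw [h z hz0, conjTranspose_mul, Matrix.mul_assoc, ← Matrix.mul_assoc _ _ U,
    ← star_eq_conjTranspose (_ * _), mem_unitaryGroup_iff'.1 h1, Matrix.one_mul, hU]

lemma exists_isoForm₁ {F : FIR p m} (hF : F.IsIsometric) :
    ∃ (γ : ℕ) (v : ℕ → Fin p → ℂ) (U : Matrix (Fin p) (Fin m) ℂ),
      Admissible F.mcMillanDegree γ v ∧ Uᴴ * U = 1 ∧ F.IsoForm₁ F.mcMillanDegree γ v U := by
  obtain ⟨l₁, l₂, U, hl, hv, hU, hFU⟩ := exists_lists_of_isIsometric hF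
  rw [← hl]
  refine ⟨l₁.length, listSeq (l₁ ++ l₂), U, admissible_listSeq hv, hU, fun z hz => ?_⟩
  rw [prodAsc_listSeq_left, prodAsc_listSeq_right, hFU z hz]

lemma IsoForm₁.isCausal {F : FIR p m} {d : ℕ} {v : ℕ → Fin p → ℂ}
    {U : Matrix (Fin p) (Fin m) ℂ} (h : F.IsoForm₁ d 0 v U) : F.IsCausal :=
  isCausal_of_eval (U := 1) (V := U) (a := 1) (b := d) (v := v) fun z hz => by
    rw [h z hz, prodAsc_of_lt zero_lt_one]

lemma IsoForm₁.isAntiCausal {F : FIR p m} {d : ℕ} {v : ℕ → Fin p → ℂ}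
    {U : Matrix (Fin p) (Fin m) ℂ} (h : F.IsoForm₁ d d v U) : F.IsAntiCausal :=
  isAntiCausal_of_eval (U := 1) (V := U) (a := 1) (b := d) (v := v) fun z hz => by
    rw [h z hz, prodAsc_of_lt (Nat.lt_succ_self d), Matrix.mul_one, Matrix.one_mul]

/-! ### The co-isometric forms -/

lemma coisoForm₁_iff_coisoForm₂ {F : FIR p m} {d γ : ℕ} {v : ℕ → Fin m → ℂ}
    (hv : Admissible d γ v) (U : Matrix (Fin p) (Fin m) ℂ) :
    F.CoisoForm₁ d γ v U ↔ F.CoisoForm₂ d γ v U := by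
  refine forall₂_congr fun z hz => ?_
  rw [inv_prodDesc (fun j h1 h2 => hv.2 j (by omega) h2) hz]

lemma coisoForm₁_iff_coisoForm₃ {F : FIR p m} {d γ : ℕ} {v : ℕ → Fin m → ℂ}
    (hv : Admissible d γ v) (U : Matrix (Fin p) (Fin m) ℂ) :
    F.CoisoForm₁ d γ v U ↔ F.CoisoForm₃ d γ v U := by
  refine forall₂_congr fun z hz => ?_
  rw [inv_prodDesc (fun j h1 h2 => hv.2 j h1 (h2.trans hv.1)) (one_div_ne_zero hz), one_div_one_div]

lemma CoisoForm₁.isCoisometric {F : FIR p m} {d γ : ℕ} {v : ℕ → Fin m → ℂ}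
    (hv : Admissible d γ v) {U : Matrix (Fin p) (Fin m) ℂ} (hU : U * Uᴴ = 1)
    (h : F.CoisoForm₁ d γ v U) : F.IsCoisometric := by
  intro z hz
  have hz0 : z ≠ 0 := by rintro rfl; simp at hz
  have h1 := mul_mem
    (prodAsc_mem_unitary (c := 1 / z) (a := γ + 1) (fun j h1 h2 => hv.2 j (by omega) h2)
      (by simp [hz]))
    (prodAsc_mem_unitary (fun j h1 h2 => hv.2 j h1 (h2.trans hv.1)) hz)
  rw [h z hz0, Matrix.mul_assoc U, conjTranspose_mul, Matrix.mul_assoc, ← Matrix.mul_assoc _ _ Uᴴ,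
    ← star_eq_conjTranspose (_ * _), mem_unitaryGroup_iff.1 h1, Matrix.one_mul, hU]

lemma exists_coisoForm₁ {F : FIR p m} (hF : F.IsCoisometric) :
    ∃ (γ : ℕ) (v : ℕ → Fin m → ℂ) (U : Matrix (Fin p) (Fin m) ℂ),
      Admissible F.mcMillanDegree γ v ∧ U * Uᴴ = 1 ∧ F.CoisoForm₁ F.mcMillanDegree γ v U := by
  obtain ⟨l₁, l₂, U, hl, hv, hU, hFU⟩ := exists_lists_of_isCoisometric hF
  rw [← hl]
  refine ⟨l₁.length, listSeq (l₁ ++ l₂), U, admissible_listSeq hv, hU, fun z hz => ?_⟩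
  rw [prodAsc_listSeq_left, prodAsc_listSeq_right, hFU z hz]

lemma CoisoForm₁.isCausal {F : FIR p m} {d : ℕ} {v : ℕ → Fin m → ℂ}
    {U : Matrix (Fin p) (Fin m) ℂ} (h : F.CoisoForm₁ d 0 v U) : F.IsCausal :=
  isCausal_of_eval (U := U) (V := 1) (a := 1) (b := d) (v := v) fun z hz => by
    rw [h z hz, prodAsc_of_lt zero_lt_one]

lemma CoisoForm₁.isAntiCausal {F : FIR p m} {d : ℕ} {v : ℕ → Fin m → ℂ}
    {U : Matrix (Fin p) (Fin m) ℂ} (h : F.CoisoForm₁ d d v U) : F.IsAntiCausal :=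
  isAntiCausal_of_eval (U := U) (V := 1) (a := 1) (b := d) (v := v) fun z hz => by
    rw [h z hz, prodAsc_of_lt (Nat.lt_succ_self d), Matrix.mul_one, Matrix.mul_one]

end FIR

end

theorem mainTheorem1 (p m d : ℕ) (F : FIR p m) (hd : F.mcMillanDegree = d) :
    (m ≤ p →
      (List.TFAE [
        F.IsIsometric,
        ∃ (γ : ℕ) (v : ℕ → Fin p → ℂ) (U : Matrix (Fin p) (Fin m) ℂ),
          FIR.Admissible d γ v ∧ Uᴴ * U = 1 ∧ F.IsoForm₁ d γ v U,
        ∃ (γ : ℕ) (v : ℕ → Fin p → ℂ) (U : Matrix (Fin p) (Fin m) ℂ),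
          FIR.Admissible d γ v ∧ Uᴴ * U = 1 ∧ F.IsoForm₂ d γ v U,
        ∃ (γ : ℕ) (v : ℕ → Fin p → ℂ) (U : Matrix (Fin p) (Fin m) ℂ),
          FIR.Admissible d γ v ∧ Uᴴ * U = 1 ∧ F.IsoForm₃ d γ v U]) ∧
      ∀ (γ : ℕ) (v : ℕ → Fin p → ℂ) (U : Matrix (Fin p) (Fin m) ℂ),
        FIR.Admissible d γ v → Uᴴ * U = 1 →
          (F.IsoForm₁ d γ v U ↔ F.IsoForm₂ d γ v U) ∧
          (F.IsoForm₁ d γ v U ↔ F.IsoForm₃ d γ v U) ∧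
          (F.IsoForm₁ d γ v U →
            (γ = 0 → F.IsCausal) ∧ (γ = d → F.IsAntiCausal))) ∧
    (p ≤ m →
      (List.TFAE [
        F.IsCoisometric,
        ∃ (γ : ℕ) (v : ℕ → Fin m → ℂ) (U : Matrix (Fin p) (Fin m) ℂ),
          FIR.Admissible d γ v ∧ U * Uᴴ = 1 ∧ F.CoisoForm₁ d γ v U,
        ∃ (γ : ℕ) (v : ℕ → Fin m → ℂ) (U : Matrix (Fin p) (Fin m) ℂ),
          FIR.Admissible d γ v ∧ U * Uᴴ = 1 ∧ F.CoisoForm₂ d γ v U,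
        ∃ (γ : ℕ) (v : ℕ → Fin m → ℂ) (U : Matrix (Fin p) (Fin m) ℂ),
          FIR.Admissible d γ v ∧ U * Uᴴ = 1 ∧ F.CoisoForm₃ d γ v U]) ∧
      ∀ (γ : ℕ) (v : ℕ → Fin m → ℂ) (U : Matrix (Fin p) (Fin m) ℂ),
        FIR.Admissible d γ v → U * Uᴴ = 1 →
          (F.CoisoForm₁ d γ v U ↔ F.CoisoForm₂ d γ v U) ∧
          (F.CoisoForm₁ d γ v U ↔ F.CoisoForm₃ d γ v U) ∧
          (F.CoisoForm₁ d γ v U →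
            (γ = 0 → F.IsCausal) ∧ (γ = d → F.IsAntiCausal))) := by
  subst hd
  refine ⟨fun _ => ⟨?_, fun γ v U hv hU => ⟨FIR.isoForm₁_iff_isoForm₂ hv U,
    FIR.isoForm₁_iff_isoForm₃ hv U, fun h => ⟨?_, ?_⟩⟩⟩,
    fun _ => ⟨?_, fun γ v U hv hU => ⟨FIR.coisoForm₁_iff_coisoForm₂ hv U,
    FIR.coisoForm₁_iff_coisoForm₃ hv U, fun h => ⟨?_, ?_⟩⟩⟩⟩
  · tfae_have 1 → 2 := FIR.exists_isoForm₁
    tfae_have 2 → 1 := fun ⟨γ, v, U, hv, hU, h⟩ => h.isIsometric hv hU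
    tfae_have 2 ↔ 3 := exists_congr fun γ => exists_congr fun v => exists_congr fun U =>
      and_congr_right fun hv => and_congr_right fun _ => FIR.isoForm₁_iff_isoForm₂ hv U
    tfae_have 2 ↔ 4 := exists_congr fun γ => exists_congr fun v => exists_congr fun U =>
      and_congr_right fun hv => and_congr_right fun _ => FIR.isoForm₁_iff_isoForm₃ hv U
    tfae_finish
  · rintro rfl
    exact h.isCausal
  · rintro rfl
    exact h.isAntiCausal
  · tfae_have 1 → 2 := FIR.exists_coisoForm₁
    tfae_have 2 → 1 := fun ⟨γ, v, U, hv, hU, h⟩ => h.isCoisometric hv hU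
    tfae_have 2 ↔ 3 := exists_congr fun γ => exists_congr fun v => exists_congr fun U =>
      and_congr_right fun hv => and_congr_right fun _ => FIR.coisoForm₁_iff_coisoForm₂ hv U
    tfae_have 2 ↔ 4 := exists_congr fun γ => exists_congr fun v => exists_congr fun U =>
      and_congr_right fun hv => and_congr_right fun _ => FIR.coisoForm₁_iff_coisoForm₃ hv U
    tfae_finish
  · rintro rfl
    exact h.isCausal
  · rintro rfl
    exact h.isAntiCausal
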